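/- Fix real numbers $\theta\ge 0$, $m>0$, $a\in(1,2)$, $\alpha,\beta\in(0,1)$ and $T>0$. For $n\ge 1$ let $\Sigma_n=\{1,\dots,n-1\}$ and $\Omega_n=\{0,1\}^{\Sigma_n}$, with the convention $\eta(0)=\alpha$, $\eta(n)=\beta$ for $\eta\in\Omega_n$. Let $\eta^{x,y}$ be $\eta$ with the values at $x$ and $y$ exchanged and $\eta^x$ be $\eta$ with the value at $x$ replaced by $1-\eta(x)$. The porous medium model with slow reservoirs is the continuous-time Markov process on $\Omega_n$ with generator $L_n=L_P+n^{a-2}L_S+L_B$, where, for $f:\Omega_n\to\mathbb R$, $$L_Pf(\eta)=\sum_{x=1}^{n-2}\big(\eta(x-1)+\eta(x+2)\big)\big\{\eta(x)(1-\eta(x+1))+\eta(x+1)(1-\eta(x))\big\}\big(f(\eta^{x,x+1})-f(\eta)\big),$$ $$L_Sf(\eta)=\sum_{x=1}^{n-2}\big\{\eta(x)(1-\eta(x+1))+\eta(x+1)(1-\eta(x))\big\}\big(f(\eta^{x,x+1})-f(\eta)\big),$$ $$L_Bf(\eta)=\frac{m}{n^\theta}I_1^\alpha(\eta)\big(f(\eta^1)-f(\eta)\big)+\frac{m}{n^\theta}I_{n-1}^\beta(\eta)\big(f(\eta^{n-1})-f(\eta)\big),\qquad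 I_z^b(\eta)=b(1-\eta(z))+(1-b)\eta(z).$$ Let $\mu_n$ be an arbitrary probability measure on $\Omega_n$, and let $\mathbb E_{\mu_n}$ be the expectation with respect to the law $\mathbb P_{\mu_n}$, on the space of càdlàg trajectories $[0,T]\to\Omega_n$, of the accelerated process $\{\eta_{tn^2}\}_{0\le t\le T}$, that is, of the Markov process with generator $n^2L_n$ and initial distribution $\mu_n$. For $\varepsilon>0$ write $\varepsilon n$ for $\lfloor\varepsilon n\rfloor$, let $\Sigma_n^\varepsilon=\{1+\varepsilon n,\dots,n-1-\varepsilon n\}$, and for $\ell\ge 1$ let $$\overleftarrow\eta^{\ell}(x)=\frac1\ell\sum_{y=x-\ell+1}^{x}\eta(y),\qquad \overrightarrow\eta^{\ell}(x)=\frac1\ell\sum_{y=x}^{x+\ell-1}\eta(y).$$ **Theorem.** Let $M<\infty$ and $t\in[0,T]$. For every family of functions $G^n_s:[0,1]\to\mathbb R$, $n\in\mathbb N$, $s\in[0,T]$, measurable in $s$, with $\|G^n_s\|_\infty\le M$ for all $n$ and $s$, $$\lim_{\varepsilon\to0}\ \limsup_{n\to+\infty}\ \mathbb E_{\mu_n}\left(\left|\int_0^t\frac1n\sum_{x\in\Sigma_n^\varepsilon}G^n_s\left(\tfrac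 xn\right)\Big\{\eta_{sn^2}(x)\eta_{sn^2}(x+1)-\overleftarrow\eta^{\varepsilon n}_{sn^2}(x)\,\overrightarrow\eta^{\varepsilon n}_{sn^2}(x+1)\Big\}\,ds\right|\right)=0.$$ Moreover the convergence is uniform over test functions bounded by $M$: the same double limit is $0$ if, for each $\varepsilon$ and $n$, the expectation is replaced by its supremum over all families $G_s:[0,1]\to\mathbb R$, $s\in[0,T]$, measurable in $s$, with $\|G_s\|_\infty\le M$ for all $s$. -/

import Mathlib

open Filter Topology MeasureTheory

noncomputable section

namespace PorousMedium

/-- The bulk `Σ_n = {1, …, n - 1}`. -/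
abbrev Site (n : ℕ) : Type := {x : ℕ // x ∈ Finset.Ioo 0 n}

/-- The configuration space `Ω_n = {0, 1}^{Σ_n}`; `true` means occupied. -/
abbrev Config (n : ℕ) : Type := Site n → Bool

/-- The value of a configuration at a site given as a natural number; only the values
at sites of the bulk matter. -/
def val {n : ℕ} (η : Config n) (x : ℕ) : Bool :=
  if h : x ∈ Finset.Ioo 0 n then η ⟨x, h⟩ else false

/-- The occupation number `η(x)` as a real number, with the convention
`η(0) = α` and `η(n) = β`. -/
def occ (α β : ℝ) {n : ℕ} (η : Config n) (x : ℕ) : ℝ :=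
  if x = 0 then α else if x = n then β else if val η x then 1 else 0

/-- The exchange `η^{x,y}` for `x, y` in the bulk. -/
def exchange {n : ℕ} (η : Config n) (x y : ℕ) : Config n :=
  fun z => val η (Equiv.swap x y (z : ℕ))

/-- The flip `η^x`. -/
def flip {n : ℕ} (η : Config n) (x : ℕ) : Config n :=
  fun z => if (z : ℕ) = x then !(η z) else η z

/-- The porous medium constraint `c_{x,x+1}(η) = η(x-1) + η(x+2)`, for `1 ≤ x ≤ n - 2`. -/
def cRate (α β : ℝ) {n : ℕ} (η : Config n) (x : ℕ) : ℝ :=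
  occ α β η (x - 1) + occ α β η (x + 2)

/-- The exclusion rate `a_{x,y}(η) = η(x)(1 - η(y))`. -/
def aRate (α β : ℝ) {n : ℕ} (η : Config n) (x y : ℕ) : ℝ :=
  occ α β η x * (1 - occ α β η y)

/-- The reservoir rate `I_z^b(η) = b(1 - η(z)) + (1 - b)η(z)`. -/
def reservoirRate (α β b : ℝ) {n : ℕ} (η : Config n) (z : ℕ) : ℝ :=
  b * (1 - occ α β η z) + (1 - b) * occ α β η z

/-- The generator `L_P` of the porous medium dynamics. -/
def genP (α β : ℝ) (n : ℕ) (f : Config n → ℝ) (η : Config n) : ℝ :=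
  ∑ x ∈ Finset.Icc 1 (n - 2), cRate α β η x * (aRate α β η x (x + 1) + aRate α β η (x + 1) x) *
    (f (exchange η x (x + 1)) - f η)

/-- The generator `L_S` of the symmetric simple exclusion dynamics. -/
def genS (α β : ℝ) (n : ℕ) (f : Config n → ℝ) (η : Config n) : ℝ :=
  ∑ x ∈ Finset.Icc 1 (n - 2), (aRate α β η x (x + 1) + aRate α β η (x + 1) x) *
    (f (exchange η x (x + 1)) - f η)

/-- The generator `L_B` of the boundary dynamics. -/
def genB (α β m θ : ℝ) (n : ℕ) (f : Config n → ℝ) (η : Config n) : ℝ :=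
  m / (n : ℝ) ^ θ * reservoirRate α β α η 1 * (f (flip η 1) - f η) +
    m / (n : ℝ) ^ θ * reservoirRate α β β η (n - 1) * (f (flip η (n - 1)) - f η)

/-- The full generator `L_n = L_P + n^{a-2} L_S + L_B`. -/
def gen (α β m θ a : ℝ) (n : ℕ) (f : Config n → ℝ) (η : Config n) : ℝ :=
  genP α β n f η + (n : ℝ) ^ (a - 2) * genS α β n f η + genB α β m θ n f η

/-- The matrix of the accelerated generator `n² L_n`; its `(η, ξ)` entry is
`n² (L_n 1_{ξ})(η)`. -/
def rateMatrix (α β m θ a : ℝ) (n : ℕ) : Matrix (Config n) (Config n) ℝ :=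
  Matrix.of fun η ξ => (n : ℝ) ^ 2 * gen α β m θ a n (Pi.single ξ 1) η

/-- The transition matrix `exp(t n² L_n)` of the accelerated process. -/
def transition (α β m θ a : ℝ) (n : ℕ) (t : ℝ) : Matrix (Config n) (Config n) ℝ :=
  NormedSpace.exp (t • rateMatrix α β m θ a n)

/-- The space `D([0,T], Ω_n)` of càdlàg trajectories (`Ω_n` is discrete). As a subtype of a
product it carries the σ-algebra generated by the coordinates, which is the Borel σ-algebra
of the Skorokhod topology. -/
abbrev PathSpace (T : ℝ) (n : ℕ) : Type :=
  {ω : Set.Icc (0 : ℝ) T → Config n //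
    ∀ s, ContinuousWithinAt ω (Set.Ici s) s ∧ ∃ l, Tendsto ω (𝓝[<] s) (𝓝 l)}

/-- `P` is the measure `ℙ_μ` on `D([0,T], Ω_n)`: the law of the Markov process with generator
`n² L_n` and initial distribution `μ`, characterized by its finite-dimensional distributions. -/
def IsLaw (α β m θ a T : ℝ) (n : ℕ) (μ : Measure (Config n)) (P : Measure (PathSpace T n)) :
    Prop :=
  ∀ (k : ℕ) (t : Fin (k + 1) → Set.Icc (0 : ℝ) T) (η : Fin (k + 1) → Config n),
    Monotone t → (t 0 : ℝ) = 0 →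
      P {ω | ∀ i, ω.1 (t i) = η i} =
        ENNReal.ofReal (μ.real {η 0} * ∏ i : Fin k,
          transition α β m θ a n ((t i.succ : ℝ) - (t i.castSucc : ℝ)) (η i.castSucc) (η i.succ))

/-- The average over the box `{x - ℓ + 1, …, x}` of size `ℓ` to the left of `x`
(used for `ℓ ≤ x`). -/
def leftAvg (α β : ℝ) {n : ℕ} (η : Config n) (ℓ x : ℕ) : ℝ :=
  1 / (ℓ : ℝ) * ∑ y ∈ Finset.Ioc (x - ℓ) x, occ α β η y

/-- The average over the box `{x, …, x + ℓ - 1}` of size `ℓ` to the right of `x`. -/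
def rightAvg (α β : ℝ) {n : ℕ} (η : Config n) (ℓ x : ℕ) : ℝ :=
  1 / (ℓ : ℝ) * ∑ y ∈ Finset.Ico x (x + ℓ), occ α β η y

/-- The set `Σ_n^ε = {1 + ⌊εn⌋, …, n - 1 - ⌊εn⌋}`. -/
def innerBulk (n : ℕ) (ε : ℝ) : Finset ℕ :=
  Finset.Icc (1 + ⌊ε * n⌋₊) (n - 1 - ⌊ε * n⌋₊)

/-- The spatial average, weighted by `g`, of
`η(x) η(x+1) - (left average at x) (right average at x + 1)` with boxes of size `⌊εn⌋`. -/
def replacementError (α β : ℝ) {n : ℕ} (ε : ℝ) (g : ℝ → ℝ) (η : Config n) : ℝ :=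
  1 / (n : ℝ) * ∑ x ∈ innerBulk n ε, g ((x : ℝ) / n) *
    (occ α β η x * occ α β η (x + 1) -
      leftAvg α β η ⌊ε * n⌋₊ x * rightAvg α β η ⌊ε * n⌋₊ (x + 1))

/-- The expectation under `P` of the absolute value of the replacement error integrated over
the time interval `[0,t]`, where `0 ≤ t ≤ T`. -/
def expectedError (α β : ℝ) {T : ℝ} (hT : 0 < T) {n : ℕ} (P : Measure (PathSpace T n))
    (ε t : ℝ) (G : ℝ → ℝ → ℝ) : ENNReal :=
  ∫⁻ ω, ENNReal.ofReal
    |∫ s in (0 : ℝ)..t, replacementError α β ε (G s) (ω.1 (Set.projIcc 0 T hT.le s))| ∂P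

/-- `G` is a test function `(s, u) ↦ G_s(u)` on `[0,T] × [0,1]`, measurable in time and
bounded by `M`. Its values elsewhere are irrelevant. -/
def IsTest (T M : ℝ) (G : ℝ → ℝ → ℝ) : Prop :=
  (∀ u ∈ Set.Icc (0 : ℝ) 1, AEMeasurable (fun s => G s u) (volume.restrict (Set.Icc 0 T))) ∧
    ∀ s ∈ Set.Icc (0 : ℝ) T, ∀ u ∈ Set.Icc (0 : ℝ) 1, |G s u| ≤ M

end PorousMedium

end

namespace PorousMedium

/-! ### Nearest-neighbour exchanges, occupation numbers and rates. -/

section Exchange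

variable {n : ℕ}

/-! Let V be the weighted average in the theorem (`boxError`). No cancellation in time is needed:
the absolute value is taken inside the time integral, and 2|V| ≤ δ + V²/δ reduces everything to the
second moment of V under the one-time laws p. In E[V·V] one factor is expanded into the differences
η(x)η(x+1) - η(x-i)η(x+1+k), and the other is kept as a weight. The kept factor moves by O(1/n)
under any exchange (`isSlow_boxError`). Hence replacing φ by φ∘exchange against the weight V p costs
O(1/n) plus a Young bound by the energy ∑ c(√(p∘exchange) - √p)², provided that the rate c is at
least 1 where φ ≠ 0 (`abs_wmean_sub_exchange_le`).

The energies come from entropy production relative to a product weight whose log-odds interpolate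
linearly between those of α and β. The reservoirs contribute at most 0, and each bond contributes
minus half its energy plus O(1/n²). As the entropy is O(n), the time integrals of the porous medium
and exclusion energies are O(1/n) and O(n^(1-a)) (`exists_energy_bound`). So constrained exchanges
are affordable over distances of order εn, at total price O(ε), whereas exclusion moves are used
only over a bounded number L of sites, where their price vanishes because a > 1.

The constraint is met by mobile clusters: two adjacent particles can walk with porous medium rates,
and can carry a third one and come back without it (`pair_walk`, `triple_walk`). To obtain a pair,
η(x) is averaged over a window of L + 1 sites. Up to a remainder bounded by 1/(L+1), the average is
a sum of terms with two particles in the window (`sum_eq_sum_pairs`). Exclusion moves bring these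
two together, they transport the particle, and they are put back (`left_pair_move`,
`right_pair_move`).

With δ and L fixed, n → ∞ kills the exclusion cost and ε → 0 the porous medium cost; what is left is
δt plus a multiple of 1/(δ(L+1)), small for δ small and then L large. -/

lemma val_exchange {b : ℕ} (hb : 1 ≤ b) (hbn : b + 1 < n) (η : Config n) (x : ℕ) :
    val (exchange η b (b + 1)) x = val η (Equiv.swap b (b + 1) x) := by
  by_cases h : x ∈ Finset.Ioo 0 n
  · rw [val, dif_pos h, exchange]
  · have h1 : x ≠ b := by rintro rfl; exact h (Finset.mem_Ioo.2 ⟨by omega, by omega⟩)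
    have h2 : x ≠ b + 1 := by rintro rfl; exact h (Finset.mem_Ioo.2 ⟨by omega, by omega⟩)
    rw [Equiv.swap_apply_of_ne_of_ne h1 h2, val, val, dif_neg h, dif_neg h]

lemma config_ext {η ξ : Config n} (h : ∀ x, val η x = val ξ x) : η = ξ := by
  funext z
  have := h z
  rwa [val, val, dif_pos z.2, dif_pos z.2] at this

lemma exchange_exchange {b : ℕ} (hb : 1 ≤ b) (hbn : b + 1 < n) (η : Config n) :
    exchange (exchange η b (b + 1)) b (b + 1) = η := by
  refine config_ext fun x => ?_
  rw [val_exchange hb hbn, val_exchange hb hbn, Equiv.swap_apply_self]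

/-- The exchange across a bond as an involutive permutation of the configuration space. -/
def exchangeEquiv {b : ℕ} (hb : 1 ≤ b) (hbn : b + 1 < n) : Equiv.Perm (Config n) :=
  Function.Involutive.toPerm (fun η => exchange η b (b + 1)) (exchange_exchange hb hbn)

lemma sum_exchange {b : ℕ} (hb : 1 ≤ b) (hbn : b + 1 < n) (f : Config n → ℝ) :
    ∑ η : Config n, f (exchange η b (b + 1)) = ∑ η, f η :=
  Equiv.sum_comp (exchangeEquiv hb hbn) f

/-- The occupation number of a bulk site as a real number, zero outside the bulk. -/
noncomputable def num (η : Config n) (x : ℕ) : ℝ := if val η x then 1 else 0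

lemma num_nonneg (η : Config n) (x : ℕ) : 0 ≤ num η x := by
  unfold num; split_ifs <;> norm_num

lemma num_le_one (η : Config n) (x : ℕ) : num η x ≤ 1 := by
  unfold num; split_ifs <;> norm_num

lemma num_eq_zero_or_one (η : Config n) (x : ℕ) : num η x = 0 ∨ num η x = 1 := by
  unfold num; split_ifs <;> simp

lemma occ_eq_num (α β : ℝ) (η : Config n) {x : ℕ} (h0 : 0 < x) (hx : x < n) :
    occ α β η x = num η x := by
  rw [occ, if_neg h0.ne', if_neg hx.ne, num]

lemma num_exchange {b : ℕ} (hb : 1 ≤ b) (hbn : b + 1 < n) (η : Config n) (x : ℕ) :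
    num (exchange η b (b + 1)) x = num η (Equiv.swap b (b + 1) x) := by
  rw [num, num, val_exchange hb hbn]

lemma num_exchange_left {b : ℕ} (hb : 1 ≤ b) (hbn : b + 1 < n) (η : Config n) :
    num (exchange η b (b + 1)) b = num η (b + 1) := by
  rw [num_exchange hb hbn, Equiv.swap_apply_left]

lemma num_exchange_right {b : ℕ} (hb : 1 ≤ b) (hbn : b + 1 < n) (η : Config n) :
    num (exchange η b (b + 1)) (b + 1) = num η b := by
  rw [num_exchange hb hbn, Equiv.swap_apply_right]

lemma num_exchange_of_ne {b x : ℕ} (hb : 1 ≤ b) (hbn : b + 1 < n) (h1 : x ≠ b)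
    (h2 : x ≠ b + 1) (η : Config n) : num (exchange η b (b + 1)) x = num η x := by
  rw [num_exchange hb hbn, Equiv.swap_apply_of_ne_of_ne h1 h2]

lemma occ_exchange_of_ne (α β : ℝ) {b x : ℕ} (hb : 1 ≤ b) (hbn : b + 1 < n) (h1 : x ≠ b)
    (h2 : x ≠ b + 1) (η : Config n) :
    occ α β (exchange η b (b + 1)) x = occ α β η x := by
  rw [occ, occ, val_exchange hb hbn, Equiv.swap_apply_of_ne_of_ne h1 h2]

lemma cRate_exchange (α β : ℝ) {b : ℕ} (hb : 1 ≤ b) (hbn : b + 1 < n) (η : Config n) :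
    cRate α β (exchange η b (b + 1)) b = cRate α β η b := by
  rw [cRate, cRate, occ_exchange_of_ne α β hb hbn (by omega) (by omega),
    occ_exchange_of_ne α β hb hbn (by omega) (by omega)]

lemma occ_nonneg {α β : ℝ} (hα : 0 ≤ α) (hβ : 0 ≤ β) (η : Config n) (x : ℕ) :
    0 ≤ occ α β η x := by
  unfold occ; split_ifs <;> first | assumption | norm_num

lemma occ_le_one {α β : ℝ} (hα : α ≤ 1) (hβ : β ≤ 1) (η : Config n) (x : ℕ) :
    occ α β η x ≤ 1 := by
  unfold occ; split_ifs <;> first | assumption | norm_num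

lemma cRate_nonneg {α β : ℝ} (hα : 0 ≤ α) (hβ : 0 ≤ β) (η : Config n) (x : ℕ) :
    0 ≤ cRate α β η x :=
  add_nonneg (occ_nonneg hα hβ _ _) (occ_nonneg hα hβ _ _)

lemma cRate_le_two {α β : ℝ} (hα : α ≤ 1) (hβ : β ≤ 1) (η : Config n) (x : ℕ) :
    cRate α β η x ≤ 2 := by
  have h1 := occ_le_one hα hβ η (x - 1)
  have h2 := occ_le_one hα hβ η (x + 2)
  unfold cRate; linarith

/-- The condition `2 ≤ b` keeps the helping site in the bulk: at b = 1 it would be site 0, whose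
value α is below 1 in the model. -/
lemma one_le_cRate_of_left {α β : ℝ} (hα : 0 ≤ α) (hβ : 0 ≤ β) (η : Config n) {b : ℕ}
    (hb : 2 ≤ b) (hbn : b - 1 < n) (h : num η (b - 1) = 1) : 1 ≤ cRate α β η b := by
  have h1 := occ_nonneg hα hβ η (b + 2)
  rw [cRate, occ_eq_num α β η (by omega) hbn, h]; linarith

lemma one_le_cRate_of_right {α β : ℝ} (hα : 0 ≤ α) (hβ : 0 ≤ β) (η : Config n) {b : ℕ}
    (hbn : b + 2 < n) (h : num η (b + 2) = 1) : 1 ≤ cRate α β η b := by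
  have h1 := occ_nonneg hα hβ η (b - 1)
  rw [cRate, occ_eq_num α β η (x := b + 2) (by omega) hbn, h]; linarith

end Exchange

/-! ### Price of moving particles: single exchanges, pairs and triples. -/

section Moves

variable {n : ℕ}

/-- The energy of the density `p` at the bond `{b, b + 1}` with jump rate `c`. -/
noncomputable def bondEnergy (c p : Config n → ℝ) (b : ℕ) : ℝ :=
  ∑ η, c η * (√(p (exchange η b (b + 1))) - √(p η)) ^ 2

lemma bondEnergy_nonneg {c : Config n → ℝ} (hc : ∀ η, 0 ≤ c η) (p : Config n → ℝ) (b : ℕ) :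
    0 ≤ bondEnergy c p b :=
  Finset.sum_nonneg fun η _ => mul_nonneg (hc η) (sq_nonneg _)

/-- `p` is the probability mass function of a probability measure. -/
structure IsProb (p : Config n → ℝ) : Prop where
  nonneg : ∀ η, 0 ≤ p η
  sum_eq : ∑ η, p η = 1

/-- `F` is bounded by `M` and changes by at most `K` under nearest-neighbour exchanges. -/
structure IsSlow (F : Config n → ℝ) (M K : ℝ) : Prop where
  bound : ∀ η, |F η| ≤ M
  lip : ∀ b, 1 ≤ b → b + 1 < n → ∀ η, |F (exchange η b (b + 1)) - F η| ≤ K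

lemma IsSlow.M_nonneg {F : Config n → ℝ} {M K : ℝ} (h : IsSlow F M K) : 0 ≤ M :=
  (abs_nonneg _).trans (h.bound fun _ => false)

/-- The expectation of `φ F` under `p`. -/
noncomputable def wmean (p F φ : Config n → ℝ) : ℝ := ∑ η, p η * φ η * F η

lemma abs_wmean_le {p F φ : Config n → ℝ} {M K c : ℝ} (hp : IsProb p) (hF : IsSlow F M K)
    (hφ : ∀ η, |φ η| ≤ c) (hc : 0 ≤ c) : |wmean p F φ| ≤ c * M := by
  calc |wmean p F φ| ≤ ∑ η, |p η * φ η * F η| := Finset.abs_sum_le_sum_abs _ _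
    _ ≤ ∑ η, p η * (c * M) := by
        refine Finset.sum_le_sum fun η _ => ?_
        rw [abs_mul, abs_mul, abs_of_nonneg (hp.nonneg η), mul_assoc]
        exact mul_le_mul_of_nonneg_left
          (mul_le_mul (hφ η) (hF.bound η) (abs_nonneg _) hc) (hp.nonneg η)
    _ = c * M := by rw [← Finset.sum_mul, hp.sum_eq, one_mul]

/-- The price of one exchange. -/
noncomputable def cost (M K A : ℝ) (c p : Config n → ℝ) (b : ℕ) : ℝ :=
  M * (A / 2 * bondEnergy c p b + 2 / A) + K

lemma cost_nonneg {M K A : ℝ} (hM : 0 ≤ M) (hK : 0 ≤ K) (hA : 0 ≤ A) {c : Config n → ℝ}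
    (hc : ∀ η, 0 ≤ c η) (p : Config n → ℝ) (b : ℕ) : 0 ≤ cost M K A c p b := by
  have := bondEnergy_nonneg hc p b
  unfold cost; positivity

/-- Factor u - v through square roots, apply Young's inequality with parameter A, and use (√u + √v)²
≤ 2(u + v). -/
lemma abs_sub_le_sqrt {u v A : ℝ} (hu : 0 ≤ u) (hv : 0 ≤ v) (hA : 0 < A) :
    |u - v| ≤ A / 2 * (√v - √u) ^ 2 + 1 / A * (u + v) := by
  set a := √u
  set b := √v
  have ha : a ^ 2 = u := Real.sq_sqrt hu
  have hb : b ^ 2 = v := Real.sq_sqrt hv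
  have h1 : |u - v| = |b - a| * (a + b) := by
    rw [← ha, ← hb, show a ^ 2 - b ^ 2 = -((b - a) * (a + b)) by ring, abs_neg, abs_mul,
      abs_of_nonneg (a := a + b) (add_nonneg (Real.sqrt_nonneg _) (Real.sqrt_nonneg _))]
  have h2 : |b - a| * (a + b) ≤ A / 2 * |b - a| ^ 2 + 1 / (2 * A) * (a + b) ^ 2 := by
    have : 0 ≤ 1 / (2 * A) * (A * |b - a| - (a + b)) ^ 2 := by positivity
    have e : 1 / (2 * A) * (A * |b - a| - (a + b)) ^ 2 =
        A / 2 * |b - a| ^ 2 + 1 / (2 * A) * (a + b) ^ 2 - |b - a| * (a + b) := by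
      field_simp; ring
    linarith
  have h3 : 1 / (2 * A) * (a + b) ^ 2 ≤ 1 / A * (u + v) := by
    have : 1 / A * (u + v) - 1 / (2 * A) * (a + b) ^ 2 = 1 / (2 * A) * (a - b) ^ 2 := by
      rw [← ha, ← hb]; field_simp; ring
    have h4 : 0 ≤ 1 / (2 * A) * (a - b) ^ 2 := by positivity
    linarith
  rw [h1]
  rw [sq_abs] at h2
  linarith

/-- The exchange preserves counting measure, so it can be transferred from φ to the product p F. The
change of p is paid by the bond energy, the change of F by `K`. The rate must be at least 1 only on
the support of φ; this is how the kinetic constraint enters. -/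
lemma abs_wmean_sub_exchange_le {p F φ c : Config n → ℝ} {M K A : ℝ} {b : ℕ}
    (hp : IsProb p) (hF : IsSlow F M K) (hb : 1 ≤ b) (hbn : b + 1 < n) (hA : 0 < A)
    (hφ : ∀ η, |φ η| ≤ 1) (hc : ∀ η, 0 ≤ c η) (hφc : ∀ η, φ η ≠ 0 → 1 ≤ c η) :
    |wmean p F φ - wmean p F fun η => φ (exchange η b (b + 1))| ≤ cost M K A c p b := by
  set s : Config n → Config n := fun η => exchange η b (b + 1) with hs
  have hss : ∀ η, s (s η) = η := exchange_exchange hb hbn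
  have hM := hF.M_nonneg
  have e1 : (wmean p F fun η => φ (s η)) = ∑ η, p (s η) * φ η * F (s η) := by
    rw [wmean, ← sum_exchange hb hbn]
    refine Finset.sum_congr rfl fun η _ => ?_
    change p (s η) * φ (s (s η)) * F (s η) = _
    rw [hss]
  have hps : ∑ η, p (s η) = 1 := (sum_exchange hb hbn p).trans hp.sum_eq
  change |wmean p F φ - wmean p F fun η => φ (s η)| ≤ _
  rw [e1, wmean, ← Finset.sum_sub_distrib]
  refine (Finset.abs_sum_le_sum_abs _ _).trans ?_
  have key : ∀ η, |p η * φ η * F η - p (s η) * φ η * F (s η)| ≤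
      M * (A / 2 * (c η * (√(p (s η)) - √(p η)) ^ 2) + 1 / A * (p η + p (s η)))
        + K * p (s η) := by
    intro η
    have h0 := hp.nonneg η
    have h0' := hp.nonneg (s η)
    have e : p η * φ η * F η - p (s η) * φ η * F (s η) =
      (φ η * (p η - p (s η))) * F η - φ η * p (s η) * (F (s η) - F η) := by ring
    rw [e]
    refine (abs_sub _ _).trans (add_le_add ?_ ?_)
    · rw [abs_mul, mul_comm]
      have h1 : |φ η * (p η - p (s η))| ≤
          A / 2 * (c η * (√(p (s η)) - √(p η)) ^ 2) + 1 / A * (p η + p (s η)) := by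
        by_cases hz : φ η = 0
        · rw [hz, zero_mul, abs_zero]
          have := hc η
          positivity
        · have h2 := abs_sub_le_sqrt h0 h0' hA
          have h3 := hφc η hz
          rw [abs_mul]
          calc |φ η| * |p η - p (s η)| ≤ 1 * |p η - p (s η)| :=
                mul_le_mul_of_nonneg_right (hφ η) (abs_nonneg _)
            _ ≤ _ := by
                rw [one_mul]
                refine h2.trans ?_
                gcongr
                exact le_mul_of_one_le_left (sq_nonneg _) h3
      exact mul_le_mul (hF.bound η) h1 (abs_nonneg _) hM
    · rw [abs_mul, abs_mul, abs_of_nonneg h0', mul_comm]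
      refine mul_le_mul (hF.lip b hb hbn η) ?_ (by positivity)
        ((abs_nonneg _).trans (hF.lip b hb hbn η))
      exact mul_le_of_le_one_left h0' (hφ η)
  refine (Finset.sum_le_sum fun η _ => key η).trans (le_of_eq ?_)
  rw [Finset.sum_add_distrib, ← Finset.mul_sum, ← Finset.mul_sum, hps, Finset.sum_add_distrib,
    ← Finset.mul_sum, ← Finset.mul_sum, Finset.sum_add_distrib, hp.sum_eq, hps, cost, bondEnergy]
  ring

/-- `χ` is invariant under the exchange across the bond `{b, b + 1}`. -/
def FixedBy (χ : Config n → ℝ) (b : ℕ) : Prop := ∀ η, χ (exchange η b (b + 1)) = χ η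

lemma FixedBy.mul {χ ψ : Config n → ℝ} {b : ℕ} (h : FixedBy χ b) (h' : FixedBy ψ b) :
    FixedBy (fun η => χ η * ψ η) b := fun η => by
  change χ _ * ψ _ = _
  rw [h η, h' η]

lemma FixedBy.one_sub {χ : Config n → ℝ} {b : ℕ} (h : FixedBy χ b) :
    FixedBy (fun η => 1 - χ η) b := fun η => by
  change 1 - χ _ = _
  rw [h η]

lemma FixedBy.prod {ι : Type*} {s : Finset ι} {χ : ι → Config n → ℝ} {b : ℕ}
    (h : ∀ i ∈ s, FixedBy (χ i) b) : FixedBy (fun η => ∏ i ∈ s, χ i η) b := fun η =>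
  Finset.prod_congr rfl fun i hi => h i hi η

lemma fixedBy_num {b x : ℕ} (hb : 1 ≤ b) (hbn : b + 1 < n) (h1 : x ≠ b) (h2 : x ≠ b + 1) :
    FixedBy (fun η : Config n => num η x) b := num_exchange_of_ne hb hbn h1 h2

lemma abs_mul_num_le {r : ℝ} (hr : |r| ≤ 1) (η : Config n) (x : ℕ) : |r * num η x| ≤ 1 := by
  rw [abs_mul, abs_of_nonneg (num_nonneg η x)]
  exact mul_le_one₀ hr (num_nonneg _ _) (num_le_one _ _)

variable {p F χ : Config n → ℝ} {M K A α β : ℝ}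

/-- An exclusion move needs no helper: the rate is 1. -/
lemma single_step (hp : IsProb p) (hF : IsSlow F M K) (hA : 0 < A) (hχ : ∀ η, |χ η| ≤ 1)
    {w : ℕ} (hw : 1 ≤ w) (hwn : w + 1 < n) (hf : FixedBy χ w) :
    |(wmean p F fun η => χ η * num η w) - wmean p F fun η => χ η * num η (w + 1)| ≤
      cost M K A (fun _ => 1) p w := by
  have h := abs_wmean_sub_exchange_le (φ := fun η => χ η * num η w) (c := fun _ => 1) hp hF hw
    hwn hA (fun η => abs_mul_num_le (hχ η) η w) (fun _ => zero_le_one) (fun _ _ => le_rfl)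
  simpa only [hf _, num_exchange_left hw hwn] using h

lemma single_walk (hp : IsProb p) (hF : IsSlow F M K) (hA : 0 < A) (hχ : ∀ η, |χ η| ≤ 1)
    {u v : ℕ} (huv : u ≤ v) (hu : 1 ≤ u) (hv : v < n) (hf : ∀ b, u ≤ b → b < v → FixedBy χ b) :
    |(wmean p F fun η => χ η * num η u) - wmean p F fun η => χ η * num η v| ≤
      ∑ b ∈ Finset.Ico u v, cost M K A (fun _ => 1) p b := by
  rw [← Real.dist_eq]
  refine dist_le_Ico_sum_of_dist_le (f := fun w => wmean p F fun η => χ η * num η w) huv ?_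
  intro k hk hkv
  rw [Real.dist_eq]
  exact single_step hp hF hA hχ (by omega) (by omega) (hf k hk hkv)

/-- A caterpillar move: the front particle jumps from j + 1 to j + 2 helped by the one at j, then
the rear one jumps from j to j + 1 helped by the one now at j + 2. -/
lemma pair_step (hα : 0 ≤ α) (hβ : 0 ≤ β) (hp : IsProb p) (hF : IsSlow F M K) (hA : 0 < A)
    (hχ : ∀ η, |χ η| ≤ 1) {j : ℕ} (hj : 1 ≤ j) (hjn : j + 2 < n) (hf0 : FixedBy χ j)
    (hf1 : FixedBy χ (j + 1)) :
    |(wmean p F fun η => χ η * num η j * num η (j + 1)) -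
        wmean p F fun η => χ η * num η (j + 1) * num η (j + 2)| ≤
      cost M K A (fun η => cRate α β η j) p j +
        cost M K A (fun η => cRate α β η (j + 1)) p (j + 1) := by
  have hc : ∀ b η, 0 ≤ cRate α β (n := n) η b := fun b η => cRate_nonneg hα hβ η b
  have h1 := abs_wmean_sub_exchange_le (φ := fun η => χ η * num η j * num η (j + 1))
    (c := fun η => cRate α β η (j + 1)) (b := j + 1) hp hF (by omega) hjn hA
    (fun η => abs_mul_num_le (abs_mul_num_le (hχ η) η _) η _) (hc _) (fun η h => by
      refine one_le_cRate_of_left hα hβ η (by omega) (by omega) ?_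
      refine (num_eq_zero_or_one η j).resolve_left fun h0 => h ?_
      simp [h0])
  have h2 := abs_wmean_sub_exchange_le (φ := fun η => χ η * num η j * num η (j + 2))
    (c := fun η => cRate α β η j) (b := j) hp hF hj (by omega) hA
    (fun η => abs_mul_num_le (abs_mul_num_le (hχ η) η _) η _) (hc _) (fun η h => by
      refine one_le_cRate_of_right hα hβ η (by omega) ?_
      refine (num_eq_zero_or_one η (j + 2)).resolve_left fun h0 => h ?_
      simp [h0])
  simp only [hf1 _, num_exchange_left (b := j + 1) (by omega) hjn,
    num_exchange_of_ne (b := j + 1) (x := j) (by omega) hjn (by omega) (by omega)] at h1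
  simp only [hf0 _, num_exchange_left (b := j) (by omega) (by omega : j + 1 < n),
    num_exchange_of_ne (b := j) (x := j + 2) (by omega) (by omega : j + 1 < n) (by omega)
      (by omega)] at h2
  refine (abs_sub_le _ (wmean p F fun η => χ η * num η j * num η (j + 2)) _).trans ?_
  linarith

/-- The front particle advances to j + 3 helped by the one at j + 1; the two others follow by
`pair_step`, with the front particle absorbed into χ. -/
lemma triple_step (hα : 0 ≤ α) (hβ : 0 ≤ β) (hp : IsProb p) (hF : IsSlow F M K) (hA : 0 < A)
    (hχ : ∀ η, |χ η| ≤ 1) {j : ℕ} (hj : 1 ≤ j) (hjn : j + 3 < n) (hf0 : FixedBy χ j)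
    (hf1 : FixedBy χ (j + 1)) (hf2 : FixedBy χ (j + 2)) :
    |(wmean p F fun η => χ η * num η j * num η (j + 1) * num η (j + 2)) -
        wmean p F fun η => χ η * num η (j + 1) * num η (j + 2) * num η (j + 3)| ≤
      cost M K A (fun η => cRate α β η j) p j +
        cost M K A (fun η => cRate α β η (j + 1)) p (j + 1) +
        cost M K A (fun η => cRate α β η (j + 2)) p (j + 2) := by
  have h3 := abs_wmean_sub_exchange_le
    (φ := fun η => χ η * num η j * num η (j + 1) * num η (j + 2))
    (c := fun η => cRate α β η (j + 2)) (b := j + 2) hp hF (by omega) hjn hA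
    (fun η => abs_mul_num_le (abs_mul_num_le (abs_mul_num_le (hχ η) η _) η _) η _)
    (fun η => cRate_nonneg hα hβ η _) (fun η h => by
      refine one_le_cRate_of_left hα hβ η (by omega) (by omega) ?_
      refine (num_eq_zero_or_one η (j + 1)).resolve_left fun h0 => h ?_
      simp [h0])
  simp only [hf2 _, num_exchange_left (b := j + 2) (by omega) hjn,
    num_exchange_of_ne (b := j + 2) (x := j) (by omega) hjn (by omega) (by omega),
    num_exchange_of_ne (b := j + 2) (x := j + 1) (by omega) hjn (by omega) (by omega)] at h3
  have h := pair_step (χ := fun η => χ η * num η (j + 3)) hα hβ hp hF hA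
    (fun η => abs_mul_num_le (hχ η) η _) hj (by omega)
    (hf0.mul (fixedBy_num hj (by omega) (by omega) (by omega)))
    (hf1.mul (fixedBy_num (by omega) (by omega) (by omega) (by omega)))
  have e1 : (fun η : Config n => χ η * num η (j + 3) * num η j * num η (j + 1)) =
      fun η => χ η * num η j * num η (j + 1) * num η (j + 3) := by funext η; ring
  have e2 : (fun η : Config n => χ η * num η (j + 3) * num η (j + 1) * num η (j + 2)) =
      fun η => χ η * num η (j + 1) * num η (j + 2) * num η (j + 3) := by funext η; ring
  rw [e1, e2] at h
  refine (abs_sub_le _ (wmean p F fun η => χ η * num η j * num η (j + 1) * num η (j + 3)) _).trans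
    ?_
  linarith

lemma sum_Ico_shift_le {f : ℕ → ℝ} (hf : ∀ b, 0 ≤ f b) {i j k r : ℕ} (hr : k + r ≤ j) :
    ∑ b ∈ Finset.Ico i k, f (b + r) ≤ ∑ b ∈ Finset.Ico i j, f b := by
  rw [Finset.sum_Ico_add' f i k r]
  exact Finset.sum_le_sum_of_subset_of_nonneg (Finset.Ico_subset_Ico (by omega) hr)
    fun b _ _ => hf b

lemma pair_walk (hα : 0 ≤ α) (hβ : 0 ≤ β) (hp : IsProb p) (hF : IsSlow F M K) (hK : 0 ≤ K)
    (hA : 0 < A) (hχ : ∀ η, |χ η| ≤ 1) {j k : ℕ} (hjk : j ≤ k) (hj : 1 ≤ j) (hk : k + 1 < n)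
    (hf : ∀ b, j ≤ b → b < k + 1 → FixedBy χ b) :
    |(wmean p F fun η => χ η * num η j * num η (j + 1)) -
        wmean p F fun η => χ η * num η k * num η (k + 1)| ≤
      2 * ∑ b ∈ Finset.Ico j (k + 1), cost M K A (fun η => cRate α β η b) p b := by
  have hnn : ∀ b, 0 ≤ cost M K A (fun η => cRate α β η b) p b := fun b =>
    cost_nonneg hF.M_nonneg hK hA.le (fun η => cRate_nonneg hα hβ η b) p b
  have h : dist (wmean p F fun η => χ η * num η j * num η (j + 1))
      (wmean p F fun η => χ η * num η k * num η (k + 1)) ≤ ∑ b ∈ Finset.Ico j k,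
        (cost M K A (fun η => cRate α β η b) p b +
          cost M K A (fun η => cRate α β η (b + 1)) p (b + 1)) := by
    refine dist_le_Ico_sum_of_dist_le
      (f := fun w => wmean p F fun η => χ η * num η w * num η (w + 1)) hjk ?_
    intro i hi hik
    rw [Real.dist_eq]
    exact pair_step hα hβ hp hF hA hχ (by omega) (by omega) (hf _ (by omega) (by omega))
      (hf _ (by omega) (by omega))
  rw [← Real.dist_eq]
  refine h.trans ?_
  rw [Finset.sum_add_distrib]
  have h0 := sum_Ico_shift_le hnn (i := j) (k := k) (j := k + 1) (r := 0) (by omega)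
  have h1 := sum_Ico_shift_le hnn (i := j) (k := k) (j := k + 1) (r := 1) (by omega)
  simp only [add_zero] at h0
  linarith

lemma triple_walk (hα : 0 ≤ α) (hβ : 0 ≤ β) (hp : IsProb p) (hF : IsSlow F M K) (hK : 0 ≤ K)
    (hA : 0 < A) (hχ : ∀ η, |χ η| ≤ 1) {j k : ℕ} (hjk : j ≤ k) (hj : 1 ≤ j) (hk : k + 2 < n)
    (hf : ∀ b, j ≤ b → b < k + 2 → FixedBy χ b) :
    |(wmean p F fun η => χ η * num η j * num η (j + 1) * num η (j + 2)) -
        wmean p F fun η => χ η * num η k * num η (k + 1) * num η (k + 2)| ≤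
      3 * ∑ b ∈ Finset.Ico j (k + 2), cost M K A (fun η => cRate α β η b) p b := by
  have hnn : ∀ b, 0 ≤ cost M K A (fun η => cRate α β η b) p b := fun b =>
    cost_nonneg hF.M_nonneg hK hA.le (fun η => cRate_nonneg hα hβ η b) p b
  have h : dist (wmean p F fun η => χ η * num η j * num η (j + 1) * num η (j + 2))
      (wmean p F fun η => χ η * num η k * num η (k + 1) * num η (k + 2)) ≤
        ∑ b ∈ Finset.Ico j k,
        (cost M K A (fun η => cRate α β η b) p b +
          cost M K A (fun η => cRate α β η (b + 1)) p (b + 1) +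
          cost M K A (fun η => cRate α β η (b + 2)) p (b + 2)) := by
    refine dist_le_Ico_sum_of_dist_le
      (f := fun w => wmean p F fun η => χ η * num η w * num η (w + 1) * num η (w + 2)) hjk ?_
    intro i hi hik
    rw [Real.dist_eq]
    exact triple_step hα hβ hp hF hA hχ (by omega) (by omega) (hf _ (by omega) (by omega))
      (hf _ (by omega) (by omega)) (hf _ (by omega) (by omega))
  rw [← Real.dist_eq]
  refine h.trans ?_
  rw [Finset.sum_add_distrib, Finset.sum_add_distrib]
  have h0 := sum_Ico_shift_le hnn (i := j) (k := k) (j := k + 2) (r := 0) (by omega)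
  have h1 := sum_Ico_shift_le hnn (i := j) (k := k) (j := k + 2) (r := 1) (by omega)
  have h2 := sum_Ico_shift_le hnn (i := j) (k := k) (j := k + 2) (r := 2) (by omega)
  simp only [add_zero] at h0
  linarith

end Moves

/-! ### Finding a pair of particles in a microscopic window and using it as a carrier. -/

section Windows

variable {n : ℕ}

/-- For 0-1 values, the first particle contributes the indicator that the window is not empty, and
every later particle k is paired with the first one j. The product over i < j records that j is the
first. Pairing with the first particle only keeps the remainder at most 1, whatever the size of the
window. -/
lemma sum_eq_sum_pairs (a : ℕ → ℝ) (L : ℕ) :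
    ∑ j ∈ Finset.range L, a j =
      ∑ k ∈ Finset.range L, ∑ j ∈ Finset.range k,
        (∏ i ∈ Finset.range j, (1 - a i)) * a j * a k +
      (1 - ∏ i ∈ Finset.range L, (1 - a i)) := by
  have h : ∀ L, ∑ j ∈ Finset.range L, (∏ i ∈ Finset.range j, (1 - a i)) * a j =
      1 - ∏ i ∈ Finset.range L, (1 - a i) := by
    intro L
    induction L with
    | zero => simp
    | succ L ih => rw [Finset.sum_range_succ, ih, Finset.prod_range_succ]; ring
  induction L with
  | zero => simp
  | succ L ih =>
    rw [Finset.sum_range_succ, ih, Finset.sum_range_succ _ L, Finset.prod_range_succ,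
      ← Finset.sum_mul, h]
    ring

variable {p F χ : Config n → ℝ} {M K A B α β : ℝ}

lemma wmean_sub (p F φ ψ : Config n → ℝ) :
    (wmean p F fun η => φ η - ψ η) = wmean p F φ - wmean p F ψ := by
  simp only [wmean, mul_sub, sub_mul, Finset.sum_sub_distrib]

lemma wmean_add (p F φ ψ : Config n → ℝ) :
    (wmean p F fun η => φ η + ψ η) = wmean p F φ + wmean p F ψ := by
  simp only [wmean, mul_add, add_mul, Finset.sum_add_distrib]

lemma wmean_sum {ι : Type*} (p F : Config n → ℝ) (s : Finset ι) (φ : ι → Config n → ℝ) :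
    (wmean p F fun η => ∑ i ∈ s, φ i η) = ∑ i ∈ s, wmean p F (φ i) := by
  simp only [wmean, Finset.mul_sum, Finset.sum_mul]
  rw [Finset.sum_comm]

lemma abs_prod_one_sub_num_le {ι : Type*} (s : Finset ι) (w : ι → ℕ) (η : Config n) :
    |∏ i ∈ s, (1 - num η (w i))| ≤ 1 := by
  rw [Finset.abs_prod]
  refine Finset.prod_le_one (fun _ _ => abs_nonneg _) fun i _ => ?_
  rcases num_eq_zero_or_one η (w i) with h | h <;> simp [h]

/-- Averaging an occupation number over a window reduces the expectation of `num x * D` to those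
with two particles in the window, up to an error `M / N`. -/
lemma abs_wmean_num_mul_le (hp : IsProb p) (hF : IsSlow F M K) {D : Config n → ℝ}
    (hD : ∀ η, |D η| ≤ 1) {x N : ℕ} (hN : 0 < N) (w : ℕ → ℕ) {s r : ℝ} (hr : 0 ≤ r)
    (h1 : ∀ j < N, |(wmean p F fun η => num η x * D η) -
      wmean p F fun η => num η (w j) * D η| ≤ s)
    (h2 : ∀ j k, j < k → k < N → |wmean p F fun η => (∏ i ∈ Finset.range j, (1 - num η (w i))) *
      num η (w j) * num η (w k) * D η| ≤ r) :
    |wmean p F fun η => num η x * D η| ≤ s + N * r + M / N := by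
  have hN' : (0 : ℝ) < N := by exact_mod_cast hN
  have hM := hF.M_nonneg
  set X := wmean p F fun η => num η x * D η with hX
  have e : ∑ j ∈ Finset.range N, (wmean p F fun η => num η (w j) * D η) =
      ∑ k ∈ Finset.range N, ∑ j ∈ Finset.range k, (wmean p F fun η =>
        (∏ i ∈ Finset.range j, (1 - num η (w i))) * num η (w j) * num η (w k) * D η) +
      wmean p F fun η => (1 - ∏ i ∈ Finset.range N, (1 - num η (w i))) * D η := by
    simp_rw [← wmean_sum]
    rw [← wmean_add]
    congr 1
    funext η
    rw [← Finset.sum_mul, sum_eq_sum_pairs (fun j => num η (w j)) N, add_mul]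
    simp only [Finset.sum_mul]
  have b1 : |N * X - ∑ j ∈ Finset.range N, (wmean p F fun η => num η (w j) * D η)| ≤ N * s := by
    rw [show N * X = ∑ j ∈ Finset.range N, X by simp, ← Finset.sum_sub_distrib]
    refine (Finset.abs_sum_le_sum_abs _ _).trans ?_
    refine (Finset.sum_le_sum fun j hj => h1 j (Finset.mem_range.1 hj)).trans ?_
    simp
  have b2 : |∑ k ∈ Finset.range N, ∑ j ∈ Finset.range k, (wmean p F fun η =>
      (∏ i ∈ Finset.range j, (1 - num η (w i))) * num η (w j) * num η (w k) * D η)| ≤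
      N * (N * r) := by
    refine (Finset.abs_sum_le_sum_abs _ _).trans ?_
    have : ∀ k ∈ Finset.range N, |∑ j ∈ Finset.range k, (wmean p F fun η =>
        (∏ i ∈ Finset.range j, (1 - num η (w i))) * num η (w j) * num η (w k) * D η)| ≤
        N * r := by
      intro k hk
      rw [Finset.mem_range] at hk
      refine (Finset.abs_sum_le_sum_abs _ _).trans ?_
      refine (Finset.sum_le_sum fun j hj => h2 j k (Finset.mem_range.1 hj) hk).trans ?_
      rw [Finset.sum_const, Finset.card_range, nsmul_eq_mul]
      gcongr
    refine (Finset.sum_le_sum this).trans ?_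
    simp
  -- The non-empty indicator is at most 1 while the sum has N terms; this is the source of `M / N`.
  have b3 : |wmean p F fun η => (1 - ∏ i ∈ Finset.range N, (1 - num η (w i))) * D η| ≤ M := by
    rw [← one_mul M]
    refine abs_wmean_le hp hF (fun η => ?_) zero_le_one
    rw [abs_mul]
    refine mul_le_one₀ ?_ (abs_nonneg _) (hD η)
    have h0 : 0 ≤ ∏ i ∈ Finset.range N, (1 - num η (w i)) :=
      Finset.prod_nonneg fun i _ => sub_nonneg.2 (num_le_one _ _)
    have h1 := abs_prod_one_sub_num_le (Finset.range N) w η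
    rw [abs_of_nonneg h0] at h1
    rw [abs_of_nonneg] <;> linarith
  have b4 : N * |X| ≤ N * s + N * (N * r) + M := by
    rw [← abs_of_pos hN', ← abs_mul, abs_of_pos hN']
    rw [e] at b1
    have t1 := abs_sub_abs_le_abs_sub (N * X) (∑ k ∈ Finset.range N, ∑ j ∈ Finset.range k,
      (wmean p F fun η => (∏ i ∈ Finset.range j, (1 - num η (w i))) * num η (w j) * num η (w k) *
        D η) + wmean p F fun η => (1 - ∏ i ∈ Finset.range N, (1 - num η (w i))) * D η)
    have t2 := abs_add_le (∑ k ∈ Finset.range N, ∑ j ∈ Finset.range k,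
      (wmean p F fun η => (∏ i ∈ Finset.range j, (1 - num η (w i))) * num η (w j) * num η (w k) *
        D η)) (wmean p F fun η => (1 - ∏ i ∈ Finset.range N, (1 - num η (w i))) * D η)
    linarith
  rw [← mul_le_mul_iff_right₀ hN']
  refine b4.trans (le_of_eq ?_)
  field_simp

lemma sum_Ico_le {f : ℕ → ℝ} (hf : ∀ b, 0 ≤ f b) {i j i' j' : ℕ} (hi : i' ≤ i) (hj : j ≤ j') :
    ∑ b ∈ Finset.Ico i j, f b ≤ ∑ b ∈ Finset.Ico i' j', f b :=
  Finset.sum_le_sum_of_subset_of_nonneg (Finset.Ico_subset_Ico hi hj) fun b _ _ => hf b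

/-- A particle moves to the right with the help of a pair of particles on its left. -/
lemma left_pair_move (hα : 0 ≤ α) (hβ : 0 ≤ β) (hp : IsProb p) (hF : IsSlow F M K) (hK : 0 ≤ K)
    (hA : 0 < A) (hB : 0 < B) (hχ : ∀ η, |χ η| ≤ 1) {u w₁ w₂ x k : ℕ} (hu : 1 ≤ u)
    (hw₁ : u ≤ w₁) (hw : w₁ < w₂) (hw₂ : w₂ ≤ x) (hk : x + 1 + k < n)
    (hf : ∀ b, w₁ ≤ b → b + 1 < n → FixedBy χ b) :
    |(wmean p F fun η => χ η * num η w₁ * num η w₂ * num η (x + 1)) -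
        wmean p F fun η => χ η * num η w₁ * num η w₂ * num η (x + 1 + k)| ≤
      4 * ∑ b ∈ Finset.Ico u x, cost M K B (fun _ => 1) p b +
      5 * ∑ b ∈ Finset.Ico u (x + 1 + k), cost M K A (fun η => cRate α β η b) p b := by
  obtain ⟨v, rfl⟩ : ∃ v, x = v + 1 := ⟨x - 1, by omega⟩
  have hnS : ∀ b, 0 ≤ cost M K B (fun _ => 1) p b :=
    fun b => cost_nonneg hF.M_nonneg hK hB.le (fun _ => zero_le_one) p b
  have hnP : ∀ b, 0 ≤ cost M K A (fun η => cRate α β η b) p b :=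
    fun b => cost_nonneg hF.M_nonneg hK hA.le (fun η => cRate_nonneg hα hβ η b) p b
  have move₂ : ∀ z, v + 1 < z → z < n →
      |(wmean p F fun η => χ η * num η w₁ * num η w₂ * num η z) -
        wmean p F fun η => χ η * num η w₁ * num η (v + 1) * num η z| ≤
        ∑ b ∈ Finset.Ico u (v + 1), cost M K B (fun _ => 1) p b := by
    intro z hz hzn
    refine le_trans (le_of_eq_of_le ?_ (single_walk (χ := fun η => χ η * num η w₁ * num η z)
      (u := w₂) (v := v + 1) hp hF hB
      (fun η => abs_mul_num_le (abs_mul_num_le (hχ η) η _) η _) hw₂ (by omega) (by omega)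
      fun b h1 h2 => ((hf b (by omega) (by omega)).mul (fixedBy_num (by omega) (by omega)
        (by omega) (by omega))).mul (fixedBy_num (by omega) (by omega) (by omega) (by omega))))
      (sum_Ico_le hnS (by omega) le_rfl)
    congr 3 <;> (funext η; ring)
  have move₁ : ∀ z, v + 1 < z → z < n →
      |(wmean p F fun η => χ η * num η w₁ * num η (v + 1) * num η z) -
        wmean p F fun η => χ η * num η v * num η (v + 1) * num η z| ≤
        ∑ b ∈ Finset.Ico u (v + 1), cost M K B (fun _ => 1) p b := by
    intro z hz hzn
    refine le_trans (le_of_eq_of_le ?_ (single_walk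
      (χ := fun η => χ η * num η (v + 1) * num η z) (u := w₁) (v := v) hp hF hB
      (fun η => abs_mul_num_le (abs_mul_num_le (hχ η) η _) η _) (by omega) (by omega) (by omega)
      fun b h1 h2 => ((hf b (by omega) (by omega)).mul (fixedBy_num (by omega) (by omega)
        (by omega) (by omega))).mul (fixedBy_num (by omega) (by omega) (by omega) (by omega))))
      (sum_Ico_le hnS (by omega) (by omega))
    congr 3 <;> (funext η; ring)
  have triple := (triple_walk (j := v) (k := v + k) hα hβ hp hF hK hA hχ (by omega) (by omega)
    (by omega) fun b h1 h2 => hf b (by omega) (by omega)).trans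
    (mul_le_mul_of_nonneg_left (sum_Ico_le hnP (i' := u) (j' := v + 1 + 1 + k) (by omega)
      (by omega)) (by norm_num))
  have pair := (pair_walk (χ := fun η => χ η * num η (v + 1 + 1 + k)) (j := v) (k := v + k)
    hα hβ hp hF hK hA (fun η => abs_mul_num_le (hχ η) η _) (by omega) (by omega) (by omega)
    fun b h1 h2 => (hf b (by omega) (by omega)).mul
      (fixedBy_num (by omega) (by omega) (by omega) (by omega))).trans
    (mul_le_mul_of_nonneg_left (sum_Ico_le hnP (i' := u) (j' := v + 1 + 1 + k) (by omega)
      (by omega)) (by norm_num))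
  have e1 : (fun η : Config n => χ η * num η (v + 1 + 1 + k) * num η v * num η (v + 1)) =
      fun η => χ η * num η v * num η (v + 1) * num η (v + 1 + 1 + k) := by funext η; ring
  have e2 : (fun η : Config n => χ η * num η (v + 1 + 1 + k) * num η (v + k) *
      num η (v + k + 1)) =
      fun η => χ η * num η (v + k) * num η (v + k + 1) * num η (v + k + 2) := by
    funext η; rw [show v + 1 + 1 + k = v + k + 2 by omega]; ring
  rw [e1, e2] at pair
  have a1 := move₂ (v + 1 + 1) (by omega) (by omega)
  have a2 := move₁ (v + 1 + 1) (by omega) (by omega)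
  have a3 := move₁ (v + 1 + 1 + k) (by omega) (by omega)
  have a4 := move₂ (v + 1 + 1 + k) (by omega) (by omega)
  rw [abs_le] at *
  constructor <;> linarith [a1.1, a1.2, a2.1, a2.2, a3.1, a3.2, a4.1, a4.2, triple.1, triple.2,
    pair.1, pair.2]

/-- A particle moves to the left with the help of a pair of particles on its right. -/
lemma right_pair_move (hα : 0 ≤ α) (hβ : 0 ≤ β) (hp : IsProb p) (hF : IsSlow F M K) (hK : 0 ≤ K)
    (hA : 0 < A) (hB : 0 < B) (hχ : ∀ η, |χ η| ≤ 1) {a x y w₁ w₂ v : ℕ} (ha : 1 ≤ a)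
    (hax : a ≤ x) (hxy : x < y) (hw₁ : y ≤ w₁) (hw : w₁ < w₂) (hw₂ : w₂ ≤ v) (hv : v < n)
    (hf : ∀ b, 1 ≤ b → b < w₂ → FixedBy χ b) :
    |(wmean p F fun η => χ η * num η w₁ * num η w₂ * num η x) -
        wmean p F fun η => χ η * num η w₁ * num η w₂ * num η a| ≤
      4 * ∑ b ∈ Finset.Ico y v, cost M K B (fun _ => 1) p b +
      7 * ∑ b ∈ Finset.Ico a (y + 1), cost M K A (fun η => cRate α β η b) p b := by
  have hnS : ∀ b, 0 ≤ cost M K B (fun _ => 1) p b :=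
    fun b => cost_nonneg hF.M_nonneg hK hB.le (fun _ => zero_le_one) p b
  have hnP : ∀ b, 0 ≤ cost M K A (fun η => cRate α β η b) p b :=
    fun b => cost_nonneg hF.M_nonneg hK hA.le (fun η => cRate_nonneg hα hβ η b) p b
  -- Route: exclusion moves gather the pair at y, y + 1. Since x need not be adjacent to y, the pair
  -- first walks to x + 1, x + 2; the triple then walks to a, and the pair returns from a + 1, a + 2
  -- to y, y + 1 before being restored. The porous medium cost is counted 2 + 3 + 2 = 7 times.
  have move₁ : ∀ z, 1 ≤ z → z < y →
      |(wmean p F fun η => χ η * num η y * num η w₂ * num η z) -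
        wmean p F fun η => χ η * num η w₁ * num η w₂ * num η z| ≤
        ∑ b ∈ Finset.Ico y v, cost M K B (fun _ => 1) p b := by
    intro z hz hzn
    refine le_trans (le_of_eq_of_le ?_ (single_walk (χ := fun η => χ η * num η w₂ * num η z)
      (u := y) (v := w₁) hp hF hB
      (fun η => abs_mul_num_le (abs_mul_num_le (hχ η) η _) η _) hw₁ (by omega) (by omega)
      fun b h1 h2 => ((hf b (by omega) (by omega)).mul (fixedBy_num (by omega) (by omega)
        (by omega) (by omega))).mul (fixedBy_num (by omega) (by omega) (by omega) (by omega))))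
      (sum_Ico_le hnS le_rfl (by omega))
    congr 3 <;> (funext η; ring)
  have move₂ : ∀ z, 1 ≤ z → z < y →
      |(wmean p F fun η => χ η * num η y * num η (y + 1) * num η z) -
        wmean p F fun η => χ η * num η y * num η w₂ * num η z| ≤
        ∑ b ∈ Finset.Ico y v, cost M K B (fun _ => 1) p b := by
    intro z hz hzn
    refine le_trans (le_of_eq_of_le ?_ (single_walk
      (χ := fun η => χ η * num η y * num η z) (u := y + 1) (v := w₂) hp hF hB
      (fun η => abs_mul_num_le (abs_mul_num_le (hχ η) η _) η _) (by omega) (by omega) (by omega)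
      fun b h1 h2 => ((hf b (by omega) (by omega)).mul (fixedBy_num (by omega) (by omega)
        (by omega) (by omega))).mul (fixedBy_num (by omega) (by omega) (by omega) (by omega))))
      (sum_Ico_le hnS (by omega) (by omega))
    congr 3 <;> (funext η; ring)
  have pair : ∀ z, a ≤ z → z < y →
      |(wmean p F fun η => χ η * num η z * num η (z + 1) * num η (z + 2)) -
        wmean p F fun η => χ η * num η y * num η (y + 1) * num η z| ≤
      2 * ∑ b ∈ Finset.Ico a (y + 1), cost M K A (fun η => cRate α β η b) p b := by
    intro z hz hzn
    refine le_trans (le_of_eq_of_le ?_ (pair_walk (χ := fun η => χ η * num η z) (j := z + 1)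
      (k := y) hα hβ hp hF hK hA (fun η => abs_mul_num_le (hχ η) η _) (by omega) (by omega)
      (by omega) fun b h1 h2 => (hf b (by omega) (by omega)).mul
        (fixedBy_num (by omega) (by omega) (by omega) (by omega))))
      (mul_le_mul_of_nonneg_left (sum_Ico_le hnP (by omega) le_rfl) (by norm_num))
    congr 3
    funext η; ring
  have triple := (triple_walk (j := a) (k := x) hα hβ hp hF hK hA hχ hax ha
    (by omega) fun b h1 h2 => hf b (by omega) (by omega)).trans
    (mul_le_mul_of_nonneg_left (sum_Ico_le hnP (i' := a) (j' := y + 1) le_rfl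
      (by omega)) (by norm_num))
  have a1 := move₁ x (by omega) (by omega)
  have a2 := move₂ x (by omega) (by omega)
  have a3 := move₁ a (by omega) (by omega)
  have a4 := move₂ a (by omega) (by omega)
  have a5 := pair x hax hxy
  have a6 := pair a le_rfl (by omega)
  rw [abs_le] at *
  constructor <;> linarith [a1.1, a1.2, a2.1, a2.2, a3.1, a3.2, a4.1, a4.2, a5.1, a5.2, a6.1,
    a6.2, triple.1, triple.2]

lemma abs_num_sub_num_le (η : Config n) (x y : ℕ) : |num η x - num η y| ≤ 1 := by
  rcases num_eq_zero_or_one η x with h | h <;> rcases num_eq_zero_or_one η y with h' | h' <;>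
    simp [h, h']

/-- The window is u, …, x, scanned from its left end: the sites required to be empty then lie to the
left of the pair and are untouched by the moves of `left_pair_move`. -/
lemma left_estimate (hα : 0 ≤ α) (hβ : 0 ≤ β) (hp : IsProb p) (hF : IsSlow F M K) (hK : 0 ≤ K)
    (hA : 0 < A) (hB : 0 < B) {u x k L : ℕ} (hu : 1 ≤ u) (hx : x = u + L) (hk : x + 1 + k < n) :
    |wmean p F fun η => num η x * (num η (x + 1) - num η (x + 1 + k))| ≤
      2 * ∑ b ∈ Finset.Ico u x, cost M K B (fun _ => 1) p b +
      (L + 1) * (4 * ∑ b ∈ Finset.Ico u x, cost M K B (fun _ => 1) p b +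
        5 * ∑ b ∈ Finset.Ico u (x + 1 + k), cost M K A (fun η => cRate α β η b) p b) +
      M / (L + 1) := by
  have hnS : ∀ b, 0 ≤ cost M K B (fun _ => 1) p b :=
    fun b => cost_nonneg hF.M_nonneg hK hB.le (fun _ => zero_le_one) p b
  have hnP : ∀ b, 0 ≤ cost M K A (fun η => cRate α β η b) p b :=
    fun b => cost_nonneg hF.M_nonneg hK hA.le (fun η => cRate_nonneg hα hβ η b) p b
  have h := abs_wmean_num_mul_le (D := fun η => num η (x + 1) - num η (x + 1 + k)) (x := x)
    (N := L + 1) hp hF (fun η => abs_num_sub_num_le η _ _) (by omega) (fun j => u + j)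
    (s := 2 * ∑ b ∈ Finset.Ico u x, cost M K B (fun _ => 1) p b)
    (r := 4 * ∑ b ∈ Finset.Ico u x, cost M K B (fun _ => 1) p b +
        5 * ∑ b ∈ Finset.Ico u (x + 1 + k), cost M K A (fun η => cRate α β η b) p b)
    (by have := Finset.sum_nonneg fun b (_ : b ∈ Finset.Ico u x) => hnS b
        have := Finset.sum_nonneg fun b (_ : b ∈ Finset.Ico u (x + 1 + k)) => hnP b
        positivity) ?_ ?_
  · push_cast at h
    exact h
  · intro j hj
    have hz : ∀ z, x < z → |(wmean p F fun η => num η (u + j) * num η z) -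
        wmean p F fun η => num η x * num η z| ≤
        ∑ b ∈ Finset.Ico u x, cost M K B (fun _ => 1) p b := fun z hz =>
      (le_of_eq_of_le (by congr 3 <;> (funext η; ring)) (single_walk (χ := fun η => num η z)
        (u := u + j) (v := x) hp hF hB
        (fun η => by rw [abs_of_nonneg (num_nonneg η z)]; exact num_le_one η z) (by omega)
        (by omega) (by omega) fun b h1 h2 => fixedBy_num (by omega) (by omega) (by omega)
          (by omega))).trans (sum_Ico_le hnS (by omega) le_rfl)
    have z1 := hz (x + 1) (by omega)
    have z2 := hz (x + 1 + k) (by omega)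
    simp only [mul_sub, wmean_sub]
    rw [abs_le] at *
    constructor <;> linarith [z1.1, z1.2, z2.1, z2.2]
  · intro j l hjl hl
    have h := left_pair_move (χ := fun η => ∏ i ∈ Finset.range j, (1 - num η (u + i))) (u := u)
      (w₁ := u + j) (w₂ := u + l) (x := x) (k := k) hα hβ hp hF hK hA hB
      (fun η => abs_prod_one_sub_num_le _ _ η) hu (by omega) (by omega) (by omega) hk
      (fun b h1 h2 => FixedBy.prod fun i hi => FixedBy.one_sub <| by
        rw [Finset.mem_range] at hi
        exact fixedBy_num (by omega) (by omega) (by omega) (by omega))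
    simpa only [mul_sub, wmean_sub] using h

/-- Mirror image of `left_estimate`: the window y, …, y + L is scanned from its right end, so that
the empty sites lie to the right of the pair. -/
lemma right_estimate (hα : 0 ≤ α) (hβ : 0 ≤ β) (hp : IsProb p) (hF : IsSlow F M K) (hK : 0 ≤ K)
    (hA : 0 < A) (hB : 0 < B) {a x y L : ℕ} (ha : 1 ≤ a) (hax : a ≤ x) (hxy : x < y)
    (hy : y + L < n) :
    |wmean p F fun η => num η y * (num η x - num η a)| ≤
      2 * ∑ b ∈ Finset.Ico y (y + L), cost M K B (fun _ => 1) p b +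
      (L + 1) * (4 * ∑ b ∈ Finset.Ico y (y + L), cost M K B (fun _ => 1) p b +
        7 * ∑ b ∈ Finset.Ico a (y + 1), cost M K A (fun η => cRate α β η b) p b) +
      M / (L + 1) := by
  have hnS : ∀ b, 0 ≤ cost M K B (fun _ => 1) p b :=
    fun b => cost_nonneg hF.M_nonneg hK hB.le (fun _ => zero_le_one) p b
  have hnP : ∀ b, 0 ≤ cost M K A (fun η => cRate α β η b) p b :=
    fun b => cost_nonneg hF.M_nonneg hK hA.le (fun η => cRate_nonneg hα hβ η b) p b
  have h := abs_wmean_num_mul_le (D := fun η => num η x - num η a) (x := y)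
    (N := L + 1) hp hF (fun η => abs_num_sub_num_le η _ _) (by omega) (fun j => y + L - j)
    (s := 2 * ∑ b ∈ Finset.Ico y (y + L), cost M K B (fun _ => 1) p b)
    (r := 4 * ∑ b ∈ Finset.Ico y (y + L), cost M K B (fun _ => 1) p b +
        7 * ∑ b ∈ Finset.Ico a (y + 1), cost M K A (fun η => cRate α β η b) p b)
    (by have := Finset.sum_nonneg fun b (_ : b ∈ Finset.Ico y (y + L)) => hnS b
        have := Finset.sum_nonneg fun b (_ : b ∈ Finset.Ico a (y + 1)) => hnP b
        positivity) ?_ ?_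
  · push_cast at h
    exact h
  · intro j hj
    have hz : ∀ z, 1 ≤ z → z < y → |(wmean p F fun η => num η y * num η z) -
        wmean p F fun η => num η (y + L - j) * num η z| ≤
        ∑ b ∈ Finset.Ico y (y + L), cost M K B (fun _ => 1) p b := fun z hz hzy =>
      (le_of_eq_of_le (by congr 3 <;> (funext η; ring)) (single_walk (χ := fun η => num η z)
        (u := y) (v := y + L - j) hp hF hB
        (fun η => by rw [abs_of_nonneg (num_nonneg η z)]; exact num_le_one η z) (by omega)
        (by omega) (by omega) fun b h1 h2 => fixedBy_num (by omega) (by omega) (by omega)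
          (by omega))).trans (sum_Ico_le hnS le_rfl (by omega))
    have z1 := hz x (by omega) hxy
    have z2 := hz a ha (by omega)
    simp only [mul_sub, wmean_sub]
    rw [abs_le] at *
    constructor <;> linarith [z1.1, z1.2, z2.1, z2.2]
  · intro j l hjl hl
    have h := right_pair_move (χ := fun η => ∏ i ∈ Finset.range j, (1 - num η (y + L - i)))
      (a := a) (x := x) (y := y) (w₁ := y + L - l) (w₂ := y + L - j) (v := y + L) hα hβ hp hF hK
      hA hB (fun η => abs_prod_one_sub_num_le _ _ η) ha hax hxy (by omega) (by omega) (by omega)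
      hy (fun b h1 h2 => FixedBy.prod fun i hi => FixedBy.one_sub <| by
        rw [Finset.mem_range] at hi
        exact fixedBy_num (by omega) (by omega) (by omega) (by omega))
    simp only [mul_sub, wmean_sub]
    refine le_of_eq_of_le ?_ h
    congr 3 <;> (funext η; ring)

end Windows

/-! ### Second moment of the replacement error under a fixed law. -/

section Static

variable {n : ℕ}

/-- The difference between the products of the occupation numbers at `x, x + 1` and at
`x - i, x + 1 + k`. -/
noncomputable def corr (i k x : ℕ) (η : Config n) : ℝ :=
  num η x * num η (x + 1) - num η (x - i) * num η (x + 1 + k)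

/-- The replacement error with weights `g x` and boxes of size `ℓ`. -/
noncomputable def boxError (ℓ : ℕ) (g : ℕ → ℝ) (η : Config n) : ℝ :=
  1 / (n : ℝ) * ∑ x ∈ Finset.Icc (1 + ℓ) (n - 1 - ℓ), g x *
    (1 / (ℓ : ℝ) ^ 2 * ∑ i ∈ Finset.range ℓ, ∑ k ∈ Finset.range ℓ, corr i k x η)

lemma leftAvg_eq (α β : ℝ) (η : Config n) {ℓ x : ℕ} (h1 : ℓ ≤ x) (h2 : x < n) :
    leftAvg α β η ℓ x = 1 / (ℓ : ℝ) * ∑ i ∈ Finset.range ℓ, num η (x - i) := by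
  rw [leftAvg]
  congr 1
  refine Finset.sum_nbij' (fun y => x - y) (fun i => x - i) ?_ ?_ ?_ ?_ ?_
  · intro y hy; simp only [Finset.mem_Ioc, Finset.mem_range] at *; omega
  · intro y hy; simp only [Finset.mem_Ioc, Finset.mem_range] at *; omega
  · intro y hy; simp only [Finset.mem_Ioc] at *; omega
  · intro y hy; simp only [Finset.mem_range] at *; omega
  · intro y hy
    simp only [Finset.mem_Ioc] at hy
    rw [occ_eq_num α β η (by omega) (by omega)]
    congr 1; omega

lemma rightAvg_eq (α β : ℝ) (η : Config n) {ℓ x : ℕ} (h1 : 0 < x) (h2 : x + ℓ ≤ n) :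
    rightAvg α β η ℓ x = 1 / (ℓ : ℝ) * ∑ k ∈ Finset.range ℓ, num η (x + k) := by
  rw [rightAvg, Finset.sum_Ico_eq_sum_range, show x + ℓ - x = ℓ by omega]
  congr 1
  refine Finset.sum_congr rfl fun k hk => ?_
  rw [Finset.mem_range] at hk
  exact occ_eq_num α β η (by omega) (by omega)

lemma replacementError_eq (α β ε : ℝ) (g : ℝ → ℝ) (η : Config n) (hℓ : 0 < ⌊ε * n⌋₊) :
    replacementError α β ε g η = boxError ⌊ε * n⌋₊ (fun x => g ((x : ℝ) / n)) η := by
  rw [replacementError, boxError, innerBulk]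
  generalize ⌊ε * n⌋₊ = ℓ at *
  congr 1
  refine Finset.sum_congr rfl fun x hx => ?_
  rw [Finset.mem_Icc] at hx
  have hℓ' : (ℓ : ℝ) ≠ 0 := by positivity
  rw [leftAvg_eq α β η (by omega) (by omega), rightAvg_eq α β η (by omega) (by omega),
    occ_eq_num α β η (by omega) (by omega), occ_eq_num α β η (x := x + 1) (by omega) (by omega)]
  congr 1
  simp only [corr, Finset.sum_sub_distrib, Finset.sum_const, Finset.card_range, nsmul_eq_mul,
    ← Finset.mul_sum, ← Finset.sum_mul]
  field_simp

lemma boxError_eq (ℓ : ℕ) (g : ℕ → ℝ) (η : Config n) :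
    boxError ℓ g η = 1 / (ℓ : ℝ) ^ 2 * ∑ i ∈ Finset.range ℓ, ∑ k ∈ Finset.range ℓ,
      1 / (n : ℝ) * ∑ x ∈ Finset.Icc (1 + ℓ) (n - 1 - ℓ), g x * corr i k x η := by
  simp only [boxError, Finset.mul_sum]
  rw [Finset.sum_comm]
  refine Finset.sum_congr rfl fun i _ => ?_
  rw [Finset.sum_comm]
  refine Finset.sum_congr rfl fun k _ => Finset.sum_congr rfl fun x _ => ?_
  ring

lemma abs_boxAvg_le {ℓ : ℕ} {f : ℕ → ℕ → ℝ} {C : ℝ} (hC : 0 ≤ C)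
    (h : ∀ i < ℓ, ∀ k < ℓ, |f i k| ≤ C) :
    |1 / (ℓ : ℝ) ^ 2 * ∑ i ∈ Finset.range ℓ, ∑ k ∈ Finset.range ℓ, f i k| ≤ C := by
  rcases Nat.eq_zero_or_pos ℓ with rfl | hℓ
  · simpa using hC
  have hℓ' : (0 : ℝ) < ℓ := by exact_mod_cast hℓ
  have h1 : |∑ i ∈ Finset.range ℓ, ∑ k ∈ Finset.range ℓ, f i k| ≤ ℓ * (ℓ * C) := by
    refine (Finset.abs_sum_le_sum_abs _ _).trans ?_
    calc _ ≤ ∑ i ∈ Finset.range ℓ, (ℓ * C) := by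
          refine Finset.sum_le_sum fun i hi => (Finset.abs_sum_le_sum_abs _ _).trans ?_
          calc _ ≤ ∑ k ∈ Finset.range ℓ, C := Finset.sum_le_sum fun k hk =>
                h i (Finset.mem_range.1 hi) k (Finset.mem_range.1 hk)
            _ = _ := by simp
      _ = _ := by simp
  rw [abs_mul, abs_of_pos (by positivity), div_mul_eq_mul_div, one_mul, div_le_iff₀ (by positivity)]
  linarith

lemma abs_corr_le (i k x : ℕ) (η : Config n) : |corr i k x η| ≤ 1 := by
  unfold corr
  rcases num_eq_zero_or_one η x with h | h <;>
  rcases num_eq_zero_or_one η (x + 1) with h1 | h1 <;>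
  rcases num_eq_zero_or_one η (x - i) with h2 | h2 <;>
  rcases num_eq_zero_or_one η (x + 1 + k) with h3 | h3 <;> rw [h, h1, h2, h3] <;> norm_num

lemma card_innerBulk_le (n ℓ : ℕ) : (Finset.Icc (1 + ℓ) (n - 1 - ℓ)).card ≤ n := by
  rw [Nat.card_Icc]; omega

lemma abs_mean_le {n : ℕ} {s : Finset ℕ} {g f : ℕ → ℝ} {M C : ℝ} (hM : 0 ≤ M)
    (hg : ∀ x ∈ s, |g x| ≤ M) (hC : ∑ x ∈ s, |f x| ≤ C) :
    |1 / (n : ℝ) * ∑ x ∈ s, g x * f x| ≤ 1 / (n : ℝ) * (M * C) := by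
  rw [abs_mul, abs_of_nonneg (by positivity : (0 : ℝ) ≤ 1 / n)]
  refine mul_le_mul_of_nonneg_left ((Finset.abs_sum_le_sum_abs _ _).trans ?_) (by positivity)
  calc ∑ x ∈ s, |g x * f x| ≤ ∑ x ∈ s, M * |f x| := Finset.sum_le_sum fun x hx => by
        rw [abs_mul]; exact mul_le_mul_of_nonneg_right (hg x hx) (abs_nonneg _)
    _ = M * ∑ x ∈ s, |f x| := by rw [Finset.mul_sum]
    _ ≤ _ := mul_le_mul_of_nonneg_left hC hM

lemma sum_abs_num_exchange_sub_le {b : ℕ} (hb : 1 ≤ b) (hbn : b + 1 < n) (η : Config n)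
    (s : Finset ℕ) (f : ℕ → ℕ) (hf : Set.InjOn f s) :
    ∑ x ∈ s, |num (exchange η b (b + 1)) (f x) - num η (f x)| ≤ 2 := by
  have e : ∑ x ∈ s, |num (exchange η b (b + 1)) (f x) - num η (f x)| =
      ∑ y ∈ s.image f, |num (exchange η b (b + 1)) y - num η y| :=
    (Finset.sum_image (f := fun y => |num (exchange η b (b + 1)) y - num η y|) hf).symm
  rw [e]
  have h1 : ∑ y ∈ s.image f, |num (exchange η b (b + 1)) y - num η y| ≤
      ∑ y ∈ s.image f ∪ {b, b + 1}, |num (exchange η b (b + 1)) y - num η y| :=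
    Finset.sum_le_sum_of_subset_of_nonneg Finset.subset_union_left fun _ _ _ => abs_nonneg _
  have h2 : ∑ y ∈ {b, b + 1}, |num (exchange η b (b + 1)) y - num η y| =
      ∑ y ∈ s.image f ∪ {b, b + 1}, |num (exchange η b (b + 1)) y - num η y| := by
    refine Finset.sum_subset Finset.subset_union_right fun y _ hy => ?_
    simp only [Finset.mem_insert, Finset.mem_singleton, not_or] at hy
    rw [num_exchange_of_ne hb hbn hy.1 hy.2, sub_self, abs_zero]
  rw [← h2, Finset.sum_pair (by omega), num_exchange_left hb hbn, num_exchange_right hb hbn] at h1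
  have := abs_num_sub_num_le η (b + 1) b
  have := abs_num_sub_num_le η b (b + 1)
  linarith

lemma abs_mul_sub_mul_le {a b a' b' : ℝ} (ha : |a| ≤ 1) (hb' : |b'| ≤ 1) :
    |a * b - a' * b'| ≤ |b - b'| + |a - a'| := by
  rw [show a * b - a' * b' = a * (b - b') + (a - a') * b' by ring]
  refine (abs_add_le _ _).trans (add_le_add ?_ ?_)
  · rw [abs_mul]; exact mul_le_of_le_one_left (abs_nonneg _) ha
  · rw [abs_mul]; exact mul_le_of_le_one_right (abs_nonneg _) hb'

lemma abs_num_le_one (η : Config n) (x : ℕ) : |num η x| ≤ 1 := by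
  rw [abs_of_nonneg (num_nonneg η x)]; exact num_le_one η x

/-- An exchange alters two sites. For fixed i, k, each of the four occupation numbers in `corr i k
x` is read at a site injective in x, so summing over x gives at most 4 · 2 = 8. -/
lemma isSlow_boxError {ℓ : ℕ} {g : ℕ → ℝ} {M : ℝ} (hn : 0 < n) (hM : 0 ≤ M)
    (hg : ∀ x ∈ Finset.Icc (1 + ℓ) (n - 1 - ℓ), |g x| ≤ M) :
    IsSlow (boxError (n := n) ℓ g) M (8 * M / n) := by
  have hn' : (0 : ℝ) < n := by exact_mod_cast hn
  constructor
  · intro η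
    rw [boxError_eq]
    refine abs_boxAvg_le hM fun i _ k _ => ?_
    refine (abs_mean_le (C := n) hM hg ?_).trans (le_of_eq (by field_simp))
    calc _ ≤ ∑ x ∈ Finset.Icc (1 + ℓ) (n - 1 - ℓ), (1 : ℝ) :=
          Finset.sum_le_sum fun x _ => abs_corr_le i k x η
      _ ≤ n := by
          rw [Finset.sum_const, nsmul_eq_mul, mul_one]
          exact_mod_cast card_innerBulk_le n ℓ
  · intro b hb hbn η
    set ξ := exchange η b (b + 1) with hξ
    rw [boxError_eq, boxError_eq, ← mul_sub, ← Finset.sum_sub_distrib]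
    simp_rw [← Finset.sum_sub_distrib, ← mul_sub, ← Finset.sum_sub_distrib, ← mul_sub]
    refine abs_boxAvg_le (by positivity) fun i hi k hk => ?_
    refine (abs_mean_le (C := 8) hM hg ?_).trans (le_of_eq (by ring))
    have hS : ∀ f : ℕ → ℕ, Set.InjOn f (Finset.Icc (1 + ℓ) (n - 1 - ℓ)) →
        ∑ x ∈ Finset.Icc (1 + ℓ) (n - 1 - ℓ), |num ξ (f x) - num η (f x)| ≤ 2 :=
      fun f hf => sum_abs_num_exchange_sub_le hb hbn η _ f hf
    have s1 := hS (fun x => x) (fun _ _ _ _ h => h)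
    have s2 := hS (fun x => x + 1) (fun _ _ _ _ h => by simpa using h)
    have s3 := hS (fun x => x - i) (fun x hx y hy h => by
      simp only [Finset.coe_Icc, Set.mem_Icc] at hx hy h; omega)
    have s4 := hS (fun x => x + 1 + k) (fun _ _ _ _ h => by simpa using h)
    calc _ ≤ ∑ x ∈ Finset.Icc (1 + ℓ) (n - 1 - ℓ), (|num ξ x - num η x| +
          |num ξ (x + 1) - num η (x + 1)| + |num ξ (x - i) - num η (x - i)| +
          |num ξ (x + 1 + k) - num η (x + 1 + k)|) := by
          refine Finset.sum_le_sum fun x _ => ?_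
          have t1 := abs_mul_sub_mul_le (a := num ξ x) (b := num ξ (x + 1)) (a' := num η x)
            (abs_num_le_one ξ _) (abs_num_le_one η (x + 1))
          have t2 := abs_mul_sub_mul_le (a := num ξ (x - i)) (b := num ξ (x + 1 + k))
            (a' := num η (x - i)) (abs_num_le_one ξ _) (abs_num_le_one η (x + 1 + k))
          rw [corr, corr, show ∀ a b c d : ℝ, a - b - (c - d) = (a - c) - (b - d) by
            intros; ring]
          refine (abs_sub _ _).trans ?_
          linarith
      _ ≤ 8 := by
          rw [Finset.sum_add_distrib, Finset.sum_add_distrib, Finset.sum_add_distrib]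
          linarith

/-- Since `lo` is injective, a bond lies in at most N of the windows of length N. -/
lemma sum_sum_Ico_le {f : ℕ → ℝ} (hf : ∀ b, 0 ≤ f b) (s : Finset ℕ) (lo : ℕ → ℕ) (N m : ℕ)
    (hlo : Set.InjOn lo s) (hs : ∀ x ∈ s, 1 ≤ lo x ∧ lo x + N ≤ m + 1) :
    ∑ x ∈ s, ∑ b ∈ Finset.Ico (lo x) (lo x + N), f b ≤ N * ∑ b ∈ Finset.Icc 1 m, f b := by
  have e : ∀ x, ∑ b ∈ Finset.Ico (lo x) (lo x + N), f b = ∑ j ∈ Finset.range N, f (lo x + j) :=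
    fun x => by rw [Finset.sum_Ico_eq_sum_range, Nat.add_sub_cancel_left]
  simp_rw [e]
  rw [Finset.sum_comm]
  have h : ∀ j ∈ Finset.range N, ∑ x ∈ s, f (lo x + j) ≤ ∑ b ∈ Finset.Icc 1 m, f b := by
    intro j hj
    rw [Finset.mem_range] at hj
    have hinj : Set.InjOn (fun x => lo x + j) s := fun x hx y hy h =>
      hlo hx hy (by simpa using h)
    rw [← Finset.sum_image hinj]
    refine Finset.sum_le_sum_of_subset_of_nonneg ?_ fun b _ _ => hf b
    intro y hy
    obtain ⟨x, hx, rfl⟩ := Finset.mem_image.1 hy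
    have := hs x hx
    rw [Finset.mem_Icc]; omega
  refine (Finset.sum_le_sum h).trans ?_
  simp

variable {p F : Config n → ℝ} {M K A B α β : ℝ}

/-- The right factor is shifted first, with carriers from a window to the left of x, then the left
factor, with carriers from a window to the right of x + 1 + k. Constants: 4L + 6 = 2 + 4(L + 1) and
12 = 5 + 7. -/
lemma abs_wmean_corr_le (hα : 0 ≤ α) (hβ : 0 ≤ β) (hp : IsProb p) (hF : IsSlow F M K)
    (hK : 0 ≤ K) (hA : 0 < A) (hB : 0 < B) {L ℓ i k x : ℕ} (hLℓ : L ≤ ℓ)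
    (hi : i < ℓ) (hk : k < ℓ) (hx : 1 + ℓ ≤ x) (hxn : x + ℓ + L < n) :
    |wmean p F (corr i k x)| ≤ 2 * M / (L + 1) +
      (4 * L + 6) * (∑ b ∈ Finset.Ico (x - L) (x - L + L), cost M K B (fun _ => 1) p b +
        ∑ b ∈ Finset.Ico (x + 1 + k) (x + 1 + k + L), cost M K B (fun _ => 1) p b) +
      12 * (L + 1) * ∑ b ∈ Finset.Ico (x - ℓ) (x - ℓ + (2 * ℓ + 1)),
        cost M K A (fun η => cRate α β η b) p b := by
  have hnS : ∀ b, 0 ≤ cost M K B (fun _ => 1) p b :=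
    fun b => cost_nonneg hF.M_nonneg hK hB.le (fun _ => zero_le_one) p b
  have hnP : ∀ b, 0 ≤ cost M K A (fun η => cRate α β η b) p b :=
    fun b => cost_nonneg hF.M_nonneg hK hA.le (fun η => cRate_nonneg hα hβ η b) p b
  have e : (corr i k x : Config n → ℝ) = fun η =>
      num η x * (num η (x + 1) - num η (x + 1 + k)) +
        num η (x + 1 + k) * (num η x - num η (x - i)) := by
    funext η; rw [corr]; ring
  rw [e, wmean_add]
  refine (abs_add_le _ _).trans ?_
  have l := left_estimate (u := x - L) (x := x) (k := k) (L := L) hα hβ hp hF hK hA hB (by omega)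
    (by omega) (by omega)
  have r := right_estimate (a := x - i) (x := x) (y := x + 1 + k) (L := L) hα hβ hp hF hK hA hB
    (by omega) (by omega) (by omega) (by omega)
  rw [show x - L + L = x by omega]
  have h1 := sum_Ico_le hnP (i := x - L) (j := x + 1 + k) (i' := x - ℓ)
    (j' := x - ℓ + (2 * ℓ + 1)) (by omega) (by omega)
  have h2 := sum_Ico_le hnP (i := x - i) (j := x + 1 + k + 1) (i' := x - ℓ)
    (j' := x - ℓ + (2 * ℓ + 1)) (by omega) (by omega)
  have h1' := mul_le_mul_of_nonneg_left h1 (by positivity : (0 : ℝ) ≤ (L + 1) * 5)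
  have h2' := mul_le_mul_of_nonneg_left h2 (by positivity : (0 : ℝ) ≤ (L + 1) * 7)
  rw [mul_div_assoc]
  linarith

/-- At most L sites x are so close to the right end that their right window may leave the bulk; each
is bounded trivially by `M`. The others are summed with `sum_sum_Ico_le`, where exclusion windows
have length L and porous medium windows 2ℓ + 1. -/
lemma sum_abs_wmean_corr_le (hα : 0 ≤ α) (hβ : 0 ≤ β) (hp : IsProb p) (hF : IsSlow F M K)
    (hK : 0 ≤ K) (hA : 0 < A) (hB : 0 < B) {L ℓ i k : ℕ} (hL : 1 ≤ L) (hLℓ : L ≤ ℓ)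
    (hi : i < ℓ) (hk : k < ℓ) :
    ∑ x ∈ Finset.Icc (1 + ℓ) (n - 1 - ℓ), |wmean p F (corr i k x)| ≤
      2 * n * M / (L + 1) + L * M +
      (8 * L + 12) * L * ∑ b ∈ Finset.Icc 1 (n - 2), cost M K B (fun _ => 1) p b +
      12 * (L + 1) * (2 * ℓ + 1) * ∑ b ∈ Finset.Icc 1 (n - 2),
        cost M K A (fun η => cRate α β η b) p b := by
  have hM := hF.M_nonneg
  have hnS : ∀ b, 0 ≤ cost M K B (fun _ => 1) p b :=
    fun b => cost_nonneg hM hK hB.le (fun _ => zero_le_one) p b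
  have hnP : ∀ b, 0 ≤ cost M K A (fun η => cRate α β η b) p b :=
    fun b => cost_nonneg hM hK hA.le (fun η => cRate_nonneg hα hβ η b) p b
  set s := Finset.Icc (1 + ℓ) (n - 1 - ℓ) with hs
  rw [← Finset.sum_filter_add_sum_filter_not s (fun x => x + ℓ + L < n)]
  set s₁ := s.filter fun x => x + ℓ + L < n with hs₁
  have hmem : ∀ x ∈ s₁, 1 + ℓ ≤ x ∧ x + ℓ + L < n := fun x hx => by
    rw [hs₁, Finset.mem_filter, hs, Finset.mem_Icc] at hx
    exact ⟨hx.1.1, hx.2⟩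
  have bad : ∑ x ∈ s.filter (fun x => ¬ x + ℓ + L < n), |wmean p F (corr i k x)| ≤ L * M := by
    have hc : (s.filter fun x => ¬ x + ℓ + L < n).card ≤ L := by
      have : (s.filter fun x => ¬ x + ℓ + L < n) ⊆ Finset.Icc (n - ℓ - L) (n - 1 - ℓ) := by
        intro x hx
        rw [Finset.mem_filter, hs, Finset.mem_Icc] at hx
        rw [Finset.mem_Icc]; omega
      refine (Finset.card_le_card this).trans ?_
      rw [Nat.card_Icc]; omega
    calc _ ≤ ∑ x ∈ s.filter (fun x => ¬ x + ℓ + L < n), M := Finset.sum_le_sum fun x _ => by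
          simpa using abs_wmean_le hp hF (abs_corr_le i k x) zero_le_one
      _ = (s.filter fun x => ¬ x + ℓ + L < n).card * M := by
          rw [Finset.sum_const, nsmul_eq_mul]
      _ ≤ L * M := mul_le_mul_of_nonneg_right (by exact_mod_cast hc) hM
  have good := Finset.sum_le_sum fun x (hx : x ∈ s₁) =>
    abs_wmean_corr_le hα hβ hp hF hK hA hB hLℓ hi hk (hmem x hx).1 (hmem x hx).2
  rw [Finset.sum_add_distrib, Finset.sum_add_distrib, ← Finset.mul_sum, ← Finset.mul_sum,
    Finset.sum_add_distrib, Finset.sum_const, nsmul_eq_mul] at good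
  have c1 : (s₁.card : ℝ) ≤ n := by
    exact_mod_cast (Finset.card_filter_le _ _).trans (card_innerBulk_le n ℓ)
  have g1 := sum_sum_Ico_le hnS s₁ (fun x => x - L) L (n - 2)
    (fun x hx y hy h => by
      have := hmem x hx; have := hmem y hy; dsimp only at h; omega)
    (fun x hx => by have := hmem x hx; omega)
  have g2 := sum_sum_Ico_le hnS s₁ (fun x => x + 1 + k) L (n - 2)
    (fun x hx y hy h => by simpa using h)
    (fun x hx => by have := hmem x hx; omega)
  have g3 := sum_sum_Ico_le hnP s₁ (fun x => x - ℓ) (2 * ℓ + 1) (n - 2)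
    (fun x hx y hy h => by
      have := hmem x hx; have := hmem y hy; dsimp only at h; omega)
    (fun x hx => by have := hmem x hx; omega)
  push_cast at g3
  have g0 : (s₁.card : ℝ) * (2 * M / (L + 1)) ≤ 2 * n * M / (L + 1) :=
    (mul_le_mul_of_nonneg_right c1 (by positivity)).trans (le_of_eq (by ring))
  have g12 := mul_le_mul_of_nonneg_left (add_le_add g1 g2)
    (by positivity : (0 : ℝ) ≤ 4 * L + 6)
  have g3' := mul_le_mul_of_nonneg_left g3 (by positivity : (0 : ℝ) ≤ 12 * (L + 1))
  linarith

lemma sum_cost_le (M K A : ℝ) (c : ℕ → Config n → ℝ) (p : Config n → ℝ) (hM : 0 ≤ M)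
    (hK : 0 ≤ K) (hA : 0 ≤ A) :
    ∑ b ∈ Finset.Icc 1 (n - 2), cost M K A (c b) p b ≤
      M * (A / 2 * ∑ b ∈ Finset.Icc 1 (n - 2), bondEnergy (c b) p b + 2 * n / A) + n * K := by
  have hc : ((Finset.Icc 1 (n - 2)).card : ℝ) ≤ n := by
    rw [Nat.card_Icc]; exact_mod_cast by omega
  simp only [cost]
  rw [Finset.sum_add_distrib, ← Finset.mul_sum, Finset.sum_add_distrib, ← Finset.mul_sum,
    Finset.sum_const, Finset.sum_const, nsmul_eq_mul, nsmul_eq_mul]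
  refine add_le_add (mul_le_mul_of_nonneg_left (add_le_add le_rfl ?_) hM)
    (mul_le_mul_of_nonneg_right hc hK)
  exact (mul_le_mul_of_nonneg_right hc (by positivity)).trans (le_of_eq (by ring))

/-- Second moment of the replacement error in terms of the Dirichlet forms. -/
theorem sum_mul_boxError_sq_le (hα : 0 ≤ α) (hβ : 0 ≤ β) (hp : IsProb p) (hn : 0 < n)
    (hB : 0 < B) {L ℓ : ℕ} (hL : 1 ≤ L) (hLℓ : L ≤ ℓ) {g : ℕ → ℝ} (hM : 0 ≤ M)
    (hg : ∀ x ∈ Finset.Icc (1 + ℓ) (n - 1 - ℓ), |g x| ≤ M) :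
    ∑ η, p η * boxError ℓ g η ^ 2 ≤ M ^ 2 * (2 / (L + 1) + L / n +
      (8 * L + 12) * L * (B / 2 * (∑ b ∈ Finset.Icc 1 (n - 2), bondEnergy (fun _ => 1) p b) / n +
        2 / B + 8 / n) +
      12 * (L + 1) * ((2 * ℓ + 1) / n) * (n / 2 * ∑ b ∈ Finset.Icc 1 (n - 2),
        bondEnergy (fun η => cRate α β η b) p b + 10)) := by
  have hn' : (0 : ℝ) < n := by exact_mod_cast hn
  have hF := isSlow_boxError hn hM hg
  have hK : 0 ≤ 8 * M / n := by positivity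
  set V : Config n → ℝ := boxError ℓ g with hV
  have e : ∑ η, p η * V η ^ 2 = 1 / (ℓ : ℝ) ^ 2 * ∑ i ∈ Finset.range ℓ, ∑ k ∈ Finset.range ℓ,
      1 / (n : ℝ) * ∑ x ∈ Finset.Icc (1 + ℓ) (n - 1 - ℓ), g x * wmean p V (corr i k x) := by
    -- V plays both roles: one factor stays as the slow weight, only the other is expanded into
    -- `corr`.
    have : ∑ η, p η * V η ^ 2 = wmean p V V := by
      simp only [wmean]; exact Finset.sum_congr rfl fun η _ => by ring
    have e2 : V = fun η => ∑ i ∈ Finset.range ℓ, ∑ k ∈ Finset.range ℓ,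
      ∑ x ∈ Finset.Icc (1 + ℓ) (n - 1 - ℓ), 1 / (ℓ : ℝ) ^ 2 * (1 / (n : ℝ) *
        (g x * corr i k x η)) := by
      funext η
      rw [hV, boxError_eq]
      simp only [Finset.mul_sum]
    have e3 : ∀ (c : ℝ) (φ : Config n → ℝ), (wmean p V fun η => c * φ η) = c * wmean p V φ := by
      intro c φ
      simp only [wmean, Finset.mul_sum]
      exact Finset.sum_congr rfl fun η _ => by ring
    rw [this]
    nth_rewrite 2 [e2]
    rw [wmean_sum]
    simp only [wmean_sum, e3, Finset.mul_sum]
  have hS := sum_cost_le M (8 * M / n) B (fun _ _ => 1) p hM hK hB.le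
  -- Young parameter n: both n/2 times a porous medium energy of order 1/n and 2n/n are of order 1.
  have hP := sum_cost_le M (8 * M / n) n (fun b η => cRate α β η b) p hM hK hn'.le
  rw [e]
  refine (le_abs_self _).trans ?_
  have hDS : 0 ≤ ∑ b ∈ Finset.Icc 1 (n - 2), bondEnergy (fun _ => 1) p b :=
    Finset.sum_nonneg fun b _ => bondEnergy_nonneg (fun _ => zero_le_one) p b
  have hDP : 0 ≤ ∑ b ∈ Finset.Icc 1 (n - 2), bondEnergy (fun η => cRate α β η b) p b :=
    Finset.sum_nonneg fun b _ => bondEnergy_nonneg (fun η => cRate_nonneg hα hβ η b) p b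
  refine abs_boxAvg_le (by positivity) fun i hi k hk => ?_
  have h := sum_abs_wmean_corr_le hα hβ hp hF hK hn' hB hL hLℓ hi hk
  have hS' := mul_le_mul_of_nonneg_left hS (by positivity : (0 : ℝ) ≤ (8 * L + 12) * L)
  have hP' := mul_le_mul_of_nonneg_left hP
    (by positivity : (0 : ℝ) ≤ 12 * (L + 1) * (2 * ℓ + 1))
  refine (abs_mean_le hM hg ((h.trans (add_le_add (add_le_add le_rfl hS') hP')))).trans
    (le_of_eq ?_)
  field_simp
  ring

end Static

/-! ### Entropy production relative to a slowly varying product weight. -/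

section EntropyProduction

variable {n : ℕ}

/-- The exclusion factor is 1 unless the two values agree, and then the exchange does nothing. -/
lemma aRate_add_mul_sub (α β : ℝ) {b : ℕ} (hb : 1 ≤ b) (hbn : b + 1 < n) (f : Config n → ℝ)
    (η : Config n) :
    (aRate α β η b (b + 1) + aRate α β η (b + 1) b) * (f (exchange η b (b + 1)) - f η) =
      f (exchange η b (b + 1)) - f η := by
  by_cases h : val η b = val η (b + 1)
  · have : exchange η b (b + 1) = η := config_ext fun x => by
      rw [val_exchange hb hbn]
      by_cases h1 : x = b
      · rw [h1, Equiv.swap_apply_left, h]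
      by_cases h2 : x = b + 1
      · rw [h2, Equiv.swap_apply_right, h]
      rw [Equiv.swap_apply_of_ne_of_ne h1 h2]
    rw [this, sub_self, mul_zero]
  · have : aRate α β η b (b + 1) + aRate α β η (b + 1) b = 1 := by
      rw [aRate, aRate, occ_eq_num α β η (by omega) (by omega),
        occ_eq_num α β η (x := b + 1) (by omega) hbn, num, num]
      cases h1 : val η b <;> cases h2 : val η (b + 1) <;> simp_all
    rw [this, one_mul]

lemma genP_eq (α β : ℝ) (f : Config n → ℝ) (η : Config n) :
    genP α β n f η =
      ∑ b ∈ Finset.Icc 1 (n - 2), cRate α β η b * (f (exchange η b (b + 1)) - f η) := by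
  refine Finset.sum_congr rfl fun b hb => ?_
  rw [Finset.mem_Icc] at hb
  rw [mul_assoc, aRate_add_mul_sub α β hb.1 (by omega)]

lemma genS_eq (α β : ℝ) (f : Config n → ℝ) (η : Config n) :
    genS α β n f η = ∑ b ∈ Finset.Icc 1 (n - 2), (f (exchange η b (b + 1)) - f η) := by
  refine Finset.sum_congr rfl fun b hb => ?_
  rw [Finset.mem_Icc] at hb
  rw [aRate_add_mul_sub α β hb.1 (by omega)]

lemma mul_log_sub_log_le {u v : ℝ} (hu : 0 < u) (hv : 0 < v) :
    u * (Real.log v - Real.log u) ≤ 2 * (√u * √v - u) := by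
  have hsu := Real.sqrt_pos.2 hu
  have hsv := Real.sqrt_pos.2 hv
  have h1 : Real.log v - Real.log u = 2 * Real.log (√v / √u) := by
    rw [Real.log_div hsv.ne' hsu.ne', Real.log_sqrt hv.le, Real.log_sqrt hu.le]; ring
  have h2 := Real.log_le_sub_one_of_pos (div_pos hsv hsu)
  have h3 : √u * √u = u := Real.mul_self_sqrt hu.le
  have h4 : u * (√v / √u) = √u * √v := by
    nth_rewrite 1 [← h3]; field_simp
  rw [h1]
  nlinarith

/-- Entropy production of the exchange across one bond. -/
lemma bond_entropy_le {p c Λ : Config n → ℝ} {b : ℕ} {κ : ℝ} (hp : IsProb p)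
    (hpos : ∀ η, 0 < p η) (hb : 1 ≤ b) (hbn : b + 1 < n) (hc : ∀ η, 0 ≤ c η)
    (hc2 : ∀ η, c η ≤ 2) (hcs : FixedBy c b)
    (hκ : ∀ η, |Λ (exchange η b (b + 1)) - Λ η| ≤ κ) :
    ∑ η, p η * (c η * ((Real.log (p (exchange η b (b + 1))) - Λ (exchange η b (b + 1))) -
      (Real.log (p η) - Λ η))) ≤ -(1 / 2) * bondEnergy c p b + κ ^ 2 := by
  set s : Config n → Config n := fun η => exchange η b (b + 1) with hs
  have hss : ∀ η, s (s η) = η := exchange_exchange hb hbn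
  have hsum : ∀ f : Config n → ℝ, ∑ η, f (s η) = ∑ η, f η := sum_exchange hb hbn
  have hcs' : ∀ η, c (s η) = c η := hcs
  have hκ0 : 0 ≤ κ := (abs_nonneg _).trans (hκ fun _ => false)
  change ∑ η, p η * (c η * ((Real.log (p (s η)) - Λ (s η)) - (Real.log (p η) - Λ η))) ≤
    -(1 / 2) * (∑ η, c η * (√(p (s η)) - √(p η)) ^ 2) + κ ^ 2
  have h1 : ∑ η, p η * (c η * (Real.log (p (s η)) - Real.log (p η))) ≤
      -∑ η, c η * (√(p (s η)) - √(p η)) ^ 2 := by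
    have e1 : ∑ η, c η * (√(p (s η)) - √(p η)) ^ 2 =
        -∑ η, c η * (2 * (√(p η) * √(p (s η)) - p η)) := by
      have e2 : ∑ η, c η * p (s η) = ∑ η, c η * p η := by
        rw [← hsum fun η => c η * p η]
        simp only [hcs']
      have e3 : ∀ η, c η * (√(p (s η)) - √(p η)) ^ 2 =
          c η * p (s η) - c η * p η - c η * (2 * (√(p η) * √(p (s η)) - p η)) := by
        intro η
        have a1 := Real.sq_sqrt (hpos η).le
        have a2 := Real.sq_sqrt (hpos (s η)).le
        linear_combination c η * a1 + c η * a2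
      rw [Finset.sum_congr rfl fun η _ => e3 η, Finset.sum_sub_distrib, Finset.sum_sub_distrib,
        e2]
      ring
    rw [e1, neg_neg]
    refine Finset.sum_le_sum fun η _ => ?_
    rw [mul_left_comm]
    exact mul_le_mul_of_nonneg_left (mul_log_sub_log_le (hpos η) (hpos (s η))) (hc η)
  have h2 : -∑ η, p η * (c η * (Λ (s η) - Λ η)) ≤
      1 / 2 * (∑ η, c η * (√(p (s η)) - √(p η)) ^ 2) + κ ^ 2 := by
    -- Symmetrising under s produces p - p∘s, which Young's inequality splits into half of the
    -- energy and κ²; c ≤ 2 is absorbed there.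
    have e1 : ∑ η, p η * (c η * (Λ (s η) - Λ η)) =
        1 / 2 * ∑ η, c η * (Λ (s η) - Λ η) * (p η - p (s η)) := by
      have e2 : ∑ η, p (s η) * (c η * (Λ η - Λ (s η))) =
          ∑ η, p η * (c η * (Λ (s η) - Λ η)) := by
        rw [← hsum fun η => p η * (c η * (Λ (s η) - Λ η))]
        simp only [hcs', hss]
      have e3 : ∑ η, c η * (Λ (s η) - Λ η) * (p η - p (s η)) =
          ∑ η, p η * (c η * (Λ (s η) - Λ η)) + ∑ η, p (s η) * (c η * (Λ η - Λ (s η))) := by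
        rw [← Finset.sum_add_distrib]
        exact Finset.sum_congr rfl fun η _ => by ring
      rw [e3, e2]; ring
    have h3 : ∀ η, -(c η * (Λ (s η) - Λ η) * (p η - p (s η))) ≤
        c η * (√(p (s η)) - √(p η)) ^ 2 + κ ^ 2 * (p η + p (s η)) := by
      intro η
      have hp0 := (hpos η).le
      have hp1 := (hpos (s η)).le
      set e := Λ (s η) - Λ η with he
      have a1 := Real.sq_sqrt hp0
      have a2 := Real.sq_sqrt hp1
      set r := √(p η)
      set r' := √(p (s η))
      have he2 : e ^ 2 ≤ κ ^ 2 := sq_le_sq' (by linarith [(abs_le.1 (hκ η)).1])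
        (abs_le.1 (hκ η)).2
      have h4 : e * (r' ^ 2 - r ^ 2) ≤ (r' - r) ^ 2 + κ ^ 2 * (r ^ 2 + r' ^ 2) / 2 := by
        have t1 : 0 ≤ ((r' - r) - e * (r' + r) / 2) ^ 2 := sq_nonneg _
        have t2 : e ^ 2 * (r' + r) ^ 2 / 4 ≤ κ ^ 2 * (r ^ 2 + r' ^ 2) / 2 := by
          have : e ^ 2 * (r' + r) ^ 2 ≤ κ ^ 2 * (2 * (r ^ 2 + r' ^ 2)) :=
            mul_le_mul he2 (by nlinarith [sq_nonneg (r' - r)]) (sq_nonneg _) (sq_nonneg _)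
          linarith
        nlinarith
      rw [← a1, ← a2]
      have t3 := mul_le_mul_of_nonneg_left h4 (hc η)
      have t4 : c η * (κ ^ 2 * (r ^ 2 + r' ^ 2) / 2) ≤ 2 * (κ ^ 2 * (r ^ 2 + r' ^ 2) / 2) :=
        mul_le_mul_of_nonneg_right (hc2 η) (by positivity)
      linarith
    have h5 := Finset.sum_le_sum fun η (_ : η ∈ Finset.univ) => h3 η
    rw [Finset.sum_neg_distrib, Finset.sum_add_distrib, ← Finset.mul_sum,
      Finset.sum_add_distrib, hsum p, hp.sum_eq] at h5
    rw [e1]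
    linarith
  have e : ∑ η, p η * (c η * ((Real.log (p (s η)) - Λ (s η)) - (Real.log (p η) - Λ η))) =
      ∑ η, p η * (c η * (Real.log (p (s η)) - Real.log (p η))) -
        ∑ η, p η * (c η * (Λ (s η) - Λ η)) := by
    rw [← Finset.sum_sub_distrib]
    exact Finset.sum_congr rfl fun η _ => by ring
  rw [e]
  linarith

lemma val_flip {z : ℕ} (hz : 0 < z) (hzn : z < n) (η : Config n) (x : ℕ) :
    val (flip η z) x = if x = z then !(val η x) else val η x := by
  by_cases h : x ∈ Finset.Ioo 0 n
  · rw [val, dif_pos h, flip, val, dif_pos h]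
  · have h1 : x ≠ z := by rintro rfl; exact h (Finset.mem_Ioo.2 ⟨hz, hzn⟩)
    rw [if_neg h1, val, val, dif_neg h, dif_neg h]

lemma flip_flip (η : Config n) (z : ℕ) : flip (flip η z) z = η := by
  funext y
  unfold flip
  split_ifs <;> simp

lemma sum_flip (z : ℕ) (f : Config n → ℝ) : ∑ η : Config n, f (flip η z) = ∑ η, f η :=
  Equiv.sum_comp (Function.Involutive.toPerm (fun η : Config n => flip η z)
    fun η => flip_flip η z) f

lemma num_flip {z : ℕ} (hz : 0 < z) (hzn : z < n) (η : Config n) (x : ℕ) :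
    num (flip η z) x = if x = z then 1 - num η x else num η x := by
  rw [num, val_flip hz hzn, num]
  split_ifs <;> simp_all

/-- The entropy production of a reservoir is nonpositive when the exponential weight matches its
density. -/
lemma reservoir_entropy_le {α β r : ℝ} (hr : r ∈ Set.Ioo (0 : ℝ) 1) {p Λ : Config n → ℝ}
    (hpos : ∀ η, 0 < p η) {z : ℕ} (hz : 0 < z) (hzn : z < n)
    (hΛ : ∀ η, Λ (flip η z) - Λ η = Real.log (r / (1 - r)) * (1 - 2 * num η z)) :
    ∑ η, p η * (reservoirRate α β r η z *
      ((Real.log (p (flip η z)) - Λ (flip η z)) - (Real.log (p η) - Λ η))) ≤ 0 := by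
  have hr0 : 0 < r := hr.1
  have hr1 : 0 < 1 - r := sub_pos.2 hr.2
  set k : Config n → ℝ := fun η => reservoirRate α β r η z * Real.exp (Λ η) with hk
  have hrate : ∀ η : Config n, reservoirRate α β r η z = r * (1 - num η z) + (1 - r) * num η z :=
    fun η => by rw [reservoirRate, occ_eq_num α β η hz hzn]
  -- Detailed balance of the reservoir for the weight exp Λ. With log y ≤ y - 1 for ratios of q = p
  -- exp(-Λ), the entropy production is then bounded by a sum that cancels under the flip.
  have hks : ∀ η, k (flip η z) = k η := by
    intro η
    have e : Λ (flip η z) = Λ η + Real.log (r / (1 - r)) * (1 - 2 * num η z) := by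
      linarith [hΛ η]
    have hl : Real.exp (Real.log (r / (1 - r))) = r / (1 - r) :=
      Real.exp_log (div_pos hr0 hr1)
    simp only [hk, hrate, e, Real.exp_add, num_flip hz hzn, if_true]
    rcases num_eq_zero_or_one η z with h | h <;> rw [h]
    · norm_num [hl]; field_simp
    · norm_num [Real.exp_neg, hl]; field_simp
  have hk0 : ∀ η, 0 ≤ k η := fun η => by
    have h1 := num_nonneg η z
    have h2 := sub_nonneg.2 (num_le_one η z)
    simp only [hk, hrate]
    positivity
  set q : Config n → ℝ := fun η => p η * Real.exp (-Λ η) with hq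
  have hq0 : ∀ η, 0 < q η := fun η => mul_pos (hpos η) (Real.exp_pos _)
  have hlq : ∀ η, Real.log (p η) - Λ η = Real.log (q η) := fun η => by
    rw [hq, Real.log_mul (hpos η).ne' (Real.exp_pos _).ne', Real.log_exp]; ring
  have key : ∀ η, p η * (reservoirRate α β r η z *
      ((Real.log (p (flip η z)) - Λ (flip η z)) - (Real.log (p η) - Λ η))) ≤
      k η * q (flip η z) - k η * q η := by
    intro η
    rw [hlq, hlq]
    have e1 : p η * (reservoirRate α β r η z * (Real.log (q (flip η z)) - Real.log (q η))) =
        k η * (q η * (Real.log (q (flip η z)) - Real.log (q η))) := by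
      have : Real.exp (Λ η) * Real.exp (-Λ η) = 1 := by rw [← Real.exp_add]; simp
      simp only [hk, hq]
      linear_combination (-(p η * (reservoirRate α β r η z * (Real.log (q (flip η z)) -
        Real.log (q η))))) * this
    rw [e1, ← mul_sub]
    refine mul_le_mul_of_nonneg_left ?_ (hk0 η)
    have h1 := Real.log_le_sub_one_of_pos (div_pos (hq0 (flip η z)) (hq0 η))
    rw [Real.log_div (hq0 _).ne' (hq0 _).ne'] at h1
    have h2 := mul_le_mul_of_nonneg_left h1 (hq0 η).le
    refine h2.trans (le_of_eq ?_)
    have := (hq0 η).ne'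
    field_simp
  refine (Finset.sum_le_sum fun η _ => key η).trans (le_of_eq ?_)
  rw [Finset.sum_sub_distrib, ← sum_flip z fun η => k η * q η]
  simp only [hks, sub_self]

/-- Linear interpolation between `u` at site `1` and `v` at site `n - 1`. -/
noncomputable def interp (n : ℕ) (u v : ℝ) (x : ℕ) : ℝ := u + (v - u) * ((x : ℝ) - 1) / (n - 2)

/-- The logarithm of the weight of a slowly varying product measure, up to a constant. -/
noncomputable def logWeight (u v : ℝ) (η : Config n) : ℝ :=
  ∑ x ∈ Finset.Icc 1 (n - 1), interp n u v x * num η x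

lemma abs_logWeight_le (hn : 3 ≤ n) (u v : ℝ) (η : Config n) :
    |logWeight u v η| ≤ n * (|u| + |v|) := by
  have hn' : (3 : ℝ) ≤ n := by exact_mod_cast hn
  have h : ∀ x ∈ Finset.Icc 1 (n - 1), |interp n u v x * num η x| ≤ |u| + |v| := by
    intro x hx
    rw [Finset.mem_Icc] at hx
    have h1 : (1 : ℝ) ≤ x := by exact_mod_cast hx.1
    have h2 : (x : ℝ) + 1 ≤ n := by exact_mod_cast (by omega : x + 1 ≤ n)
    rw [abs_mul, abs_of_nonneg (num_nonneg η x)]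
    refine (mul_le_of_le_one_right (abs_nonneg _) (num_le_one η x)).trans ?_
    set τ := ((x : ℝ) - 1) / (n - 2) with hτ
    have t0 : 0 ≤ τ := div_nonneg (by linarith) (by linarith)
    have t1 : τ ≤ 1 := (div_le_one (by linarith)).2 (by linarith)
    have e : interp n u v x = (1 - τ) * u + τ * v := by rw [interp, hτ, mul_div_assoc]; ring
    rw [e]
    refine (abs_add_le _ _).trans (add_le_add ?_ ?_) <;> rw [abs_mul]
    · rw [abs_of_nonneg (by linarith : 0 ≤ 1 - τ)]
      exact mul_le_of_le_one_left (abs_nonneg _) (by linarith)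
    · rw [abs_of_nonneg t0]
      exact mul_le_of_le_one_left (abs_nonneg _) t1
  refine (Finset.abs_sum_le_sum_abs _ _).trans ((Finset.sum_le_sum h).trans ?_)
  rw [Finset.sum_const, nsmul_eq_mul, Nat.card_Icc]
  refine mul_le_mul_of_nonneg_right ?_ (by positivity)
  exact_mod_cast by omega

/-- The slope of the profile is (v - u)/(n - 2), and n ≤ 3(n - 2) for n ≥ 3. -/
lemma abs_logWeight_exchange_sub_le (hn : 3 ≤ n) (u v : ℝ) {b : ℕ} (hb : 1 ≤ b)
    (hbn : b + 1 < n) (η : Config n) :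
    |logWeight u v (exchange η b (b + 1)) - logWeight u v η| ≤ 3 * |v - u| / n := by
  have hn' : (3 : ℝ) ≤ n := by exact_mod_cast hn
  have e : logWeight u v (exchange η b (b + 1)) - logWeight u v η =
      (v - u) / (n - 2) * (num η b - num η (b + 1)) := by
    rw [logWeight, logWeight, ← Finset.sum_sub_distrib]
    simp_rw [← mul_sub]
    have h : ∑ x ∈ {b, b + 1}, interp n u v x * (num (exchange η b (b + 1)) x - num η x) =
        ∑ x ∈ Finset.Icc 1 (n - 1),
          interp n u v x * (num (exchange η b (b + 1)) x - num η x) := by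
      refine Finset.sum_subset (fun x hx => ?_) fun x _ hx => ?_
      · simp only [Finset.mem_insert, Finset.mem_singleton] at hx
        rw [Finset.mem_Icc]; omega
      · simp only [Finset.mem_insert, Finset.mem_singleton, not_or] at hx
        rw [num_exchange_of_ne hb hbn hx.1 hx.2, sub_self, mul_zero]
    rw [← h, Finset.sum_pair (by omega), num_exchange_left hb hbn, num_exchange_right hb hbn,
      interp, interp]
    push_cast
    have : (n : ℝ) - 2 ≠ 0 := by linarith
    field_simp
    ring
  rw [e, abs_mul, abs_div, abs_of_nonneg (by linarith : (0 : ℝ) ≤ n - 2)]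
  refine (mul_le_of_le_one_right (div_nonneg (abs_nonneg (v - u)) (by linarith)) (abs_num_sub_num_le η _ _)).trans ?_
  rw [div_le_div_iff₀ (by linarith) (by linarith)]
  nlinarith [abs_nonneg (v - u)]

lemma logWeight_flip_sub (u v : ℝ) {z : ℕ} (hz : 0 < z) (hzn : z < n) (η : Config n) :
    logWeight u v (flip η z) - logWeight u v η = interp n u v z * (1 - 2 * num η z) := by
  rw [logWeight, logWeight, ← Finset.sum_sub_distrib, Finset.sum_eq_single z]
  · rw [num_flip hz hzn, if_pos rfl]; ring
  · intro x _ hx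
    rw [num_flip hz hzn, if_neg hx, sub_self]
  · intro h
    exact absurd (Finset.mem_Icc.2 ⟨hz, by omega⟩) h

/-- The Dirichlet form of the porous medium part. -/
noncomputable def energyP (α β : ℝ) (p : Config n → ℝ) : ℝ :=
  ∑ b ∈ Finset.Icc 1 (n - 2), bondEnergy (fun η => cRate α β η b) p b

/-- The Dirichlet form of the exclusion part. -/
noncomputable def energyS (p : Config n → ℝ) : ℝ :=
  ∑ b ∈ Finset.Icc 1 (n - 2), bondEnergy (fun _ => 1) p b

/-- The log-density with respect to the slowly varying product measure matching the reservoirs. -/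
noncomputable def logDensity (α β : ℝ) (p : Config n → ℝ) (η : Config n) : ℝ :=
  Real.log (p η) - logWeight (Real.log (α / (1 - α))) (Real.log (β / (1 - β))) η

/-- The profile takes the reservoirs' log-odds at sites 1 and n - 1, so the boundary terms have a
sign and the bound does not see m or θ. Each of the two bulk parts has at most n bonds with error κ²
= 9(v - u)²/n², whence 9 + 9 = 18. -/
theorem sum_mul_gen_logDensity_le {α β m θ a : ℝ} (hα : α ∈ Set.Ioo (0 : ℝ) 1)
    (hβ : β ∈ Set.Ioo (0 : ℝ) 1) (hm : 0 < m) (ha : a ≤ 2) (hn : 3 ≤ n) {p : Config n → ℝ}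
    (hp : IsProb p) (hpos : ∀ η, 0 < p η) :
    ∑ η, p η * gen α β m θ a n (logDensity α β p) η ≤
      -(1 / 2) * (energyP α β p + (n : ℝ) ^ (a - 2) * energyS p) +
        18 * (Real.log (β / (1 - β)) - Real.log (α / (1 - α))) ^ 2 / n := by
  have hn' : (3 : ℝ) ≤ n := by exact_mod_cast hn
  set u := Real.log (α / (1 - α)) with hu
  set v := Real.log (β / (1 - β)) with hv
  set Λ : Config n → ℝ := logWeight u v with hΛ
  set κ := 3 * |v - u| / n with hκ
  have hκn : n * κ ^ 2 = 9 * (v - u) ^ 2 / n := by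
    rw [hκ, div_pow, mul_pow, sq_abs]; field_simp; ring
  have hcard : ((Finset.Icc 1 (n - 2)).card : ℝ) ≤ n := by
    rw [Nat.card_Icc]; exact_mod_cast by omega
  have hP : ∑ η, p η * genP α β n (logDensity α β p) η ≤
      -(1 / 2) * energyP α β p + 9 * (v - u) ^ 2 / n := by
    simp only [genP_eq, Finset.mul_sum]
    rw [Finset.sum_comm]
    have h : ∀ b ∈ Finset.Icc 1 (n - 2), ∑ η, p η * (cRate α β η b *
        (logDensity α β p (exchange η b (b + 1)) - logDensity α β p η)) ≤
        -(1 / 2) * bondEnergy (fun η => cRate α β η b) p b + κ ^ 2 := by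
      intro b hb
      rw [Finset.mem_Icc] at hb
      exact bond_entropy_le hp hpos hb.1 (by omega)
        (fun η => cRate_nonneg hα.1.le hβ.1.le η b) (fun η => cRate_le_two hα.2.le hβ.2.le η b)
        (cRate_exchange α β hb.1 (by omega))
        (abs_logWeight_exchange_sub_le hn u v hb.1 (by omega))
    refine (Finset.sum_le_sum h).trans ?_
    rw [Finset.sum_add_distrib, ← Finset.mul_sum, Finset.sum_const, nsmul_eq_mul, ← hκn]
    exact add_le_add le_rfl (mul_le_mul_of_nonneg_right hcard (sq_nonneg _))
  have hS : ∑ η, p η * genS α β n (logDensity α β p) η ≤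
      -(1 / 2) * energyS p + 9 * (v - u) ^ 2 / n := by
    simp only [genS_eq, Finset.mul_sum]
    rw [Finset.sum_comm]
    have h : ∀ b ∈ Finset.Icc 1 (n - 2), ∑ η, p η *
        (logDensity α β p (exchange η b (b + 1)) - logDensity α β p η) ≤
        -(1 / 2) * bondEnergy (fun _ => 1) p b + κ ^ 2 := by
      intro b hb
      rw [Finset.mem_Icc] at hb
      have := bond_entropy_le (c := fun _ => 1) hp hpos hb.1 (by omega)
        (fun _ => zero_le_one) (fun _ => one_le_two) (fun _ => rfl)
        (abs_logWeight_exchange_sub_le hn u v hb.1 (by omega))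
      simp only [one_mul] at this
      exact this
    refine (Finset.sum_le_sum h).trans ?_
    rw [Finset.sum_add_distrib, ← Finset.mul_sum, Finset.sum_const, nsmul_eq_mul, ← hκn]
    exact add_le_add le_rfl (mul_le_mul_of_nonneg_right hcard (sq_nonneg _))
  have hl : ∑ η, p η * (reservoirRate α β α η 1 *
      (logDensity α β p (flip η 1) - logDensity α β p η)) ≤ 0 := by
    refine reservoir_entropy_le hα hpos one_pos (by omega) fun η => ?_
    rw [logWeight_flip_sub u v one_pos (by omega), interp]
    simp [hu]
  have hr : ∑ η, p η * (reservoirRate α β β η (n - 1) *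
      (logDensity α β p (flip η (n - 1)) - logDensity α β p η)) ≤ 0 := by
    refine reservoir_entropy_le hβ hpos (by omega) (by omega) fun η => ?_
    rw [logWeight_flip_sub u v (by omega) (by omega), interp, Nat.cast_sub (by omega)]
    have : (n : ℝ) - 2 ≠ 0 := by linarith
    congr 1
    push_cast
    field_simp
    ring
  have hpow0 : 0 ≤ (n : ℝ) ^ (a - 2) := by positivity
  have hpow1 : (n : ℝ) ^ (a - 2) ≤ 1 :=
    Real.rpow_le_one_of_one_le_of_nonpos (by linarith) (by linarith)
  have hmn : 0 ≤ m / (n : ℝ) ^ θ := by positivity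
  have e : ∑ η, p η * gen α β m θ a n (logDensity α β p) η =
      ∑ η, p η * genP α β n (logDensity α β p) η +
      (n : ℝ) ^ (a - 2) * ∑ η, p η * genS α β n (logDensity α β p) η +
      (m / (n : ℝ) ^ θ * ∑ η, p η * (reservoirRate α β α η 1 *
        (logDensity α β p (flip η 1) - logDensity α β p η)) +
      m / (n : ℝ) ^ θ * ∑ η, p η * (reservoirRate α β β η (n - 1) *
        (logDensity α β p (flip η (n - 1)) - logDensity α β p η))) := by
    simp only [Finset.mul_sum, ← Finset.sum_add_distrib, gen, genB]
    exact Finset.sum_congr rfl fun η _ => by ring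
  rw [e]
  have t1 := mul_le_mul_of_nonneg_left hS hpow0
  have t2 := mul_nonpos_of_nonneg_of_nonpos hmn hl
  have t3 := mul_nonpos_of_nonneg_of_nonpos hmn hr
  have t4 : (n : ℝ) ^ (a - 2) * (9 * (v - u) ^ 2 / n) ≤ 9 * (v - u) ^ 2 / n :=
    mul_le_of_le_one_left (by positivity) hpow1
  have t5 : 18 * (v - u) ^ 2 / n = 9 * (v - u) ^ 2 / n + 9 * (v - u) ^ 2 / n := by ring
  rw [t5]
  linarith

end EntropyProduction

/-! ### Differentiability and positivity of matrix exponentials. -/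

section MatrixSemigroup

open scoped Matrix.Norms.Operator

variable {ι : Type*} [Fintype ι] [DecidableEq ι]

lemma hasDerivAt_exp_smul_apply (Q : Matrix ι ι ℝ) (i j : ι) (t : ℝ) :
    HasDerivAt (fun t : ℝ => NormedSpace.exp (t • Q) i j) ((NormedSpace.exp (t • Q) * Q) i j) t :=
  (LinearMap.toContinuousLinearMap (Matrix.entryLinearMap ℝ ℝ i j)).hasFDerivAt.comp_hasDerivAt t
    (hasDerivAt_exp_smul_const (𝕂 := ℝ) Q t)

lemma hasSum_exp_apply (B : Matrix ι ι ℝ) (i j : ι) :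
    HasSum (fun k : ℕ => ((k.factorial : ℝ)⁻¹ • B ^ k) i j) (NormedSpace.exp B i j) :=
  (NormedSpace.exp_series_hasSum_exp' (𝕂 := ℝ) B).mapL
    (LinearMap.toContinuousLinearMap (Matrix.entryLinearMap ℝ ℝ i j))

lemma pow_apply_nonneg {B : Matrix ι ι ℝ} (hB : ∀ i j, 0 ≤ B i j) (k : ℕ) (i j : ι) :
    0 ≤ (B ^ k) i j := by
  induction k generalizing i j with
  | zero => rw [pow_zero, Matrix.one_apply]; split_ifs <;> norm_num
  | succ k ih =>
    rw [pow_succ, Matrix.mul_apply]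
    exact Finset.sum_nonneg fun l _ => mul_nonneg (ih i l) (hB l j)

lemma one_apply_le_exp_apply {B : Matrix ι ι ℝ} (hB : ∀ i j, 0 ≤ B i j) (i j : ι) :
    (1 : Matrix ι ι ℝ) i j ≤ NormedSpace.exp B i j := by
  have h := le_hasSum (hasSum_exp_apply B i j) 0 fun k _ => by
    rw [Matrix.smul_apply]
    exact smul_nonneg (by positivity) (pow_apply_nonneg hB k i j)
  simpa using h

lemma exp_smul_one_add (B : Matrix ι ι ℝ) (c : ℝ) :
    NormedSpace.exp (B + c • (1 : Matrix ι ι ℝ)) = Real.exp c • NormedSpace.exp B := by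
  have h : NormedSpace.exp (c • (1 : Matrix ι ι ℝ)) = Real.exp c • (1 : Matrix ι ι ℝ) := by
    rw [Matrix.smul_one_eq_diagonal, Matrix.exp_diagonal, Matrix.smul_one_eq_diagonal]
    congr 1
    funext i
    rw [Pi.coe_exp, Real.exp_eq_exp_ℝ]
  rw [Matrix.exp_add_of_commute _ _ ((Commute.one_right B).smul_right c), h, mul_smul_comm,
    mul_one]

/-- The exponential of a matrix with nonnegative off-diagonal entries dominates a positive multiple
of the identity. -/
lemma exists_pos_mul_one_le_exp {Q : Matrix ι ι ℝ} (hQ : ∀ i j, i ≠ j → 0 ≤ Q i j) {t : ℝ}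
    (ht : 0 ≤ t) :
    ∃ r > 0, ∀ i j, r * (1 : Matrix ι ι ℝ) i j ≤ NormedSpace.exp (t • Q) i j := by
  -- Adding l times the identity makes all entries nonnegative; the exponential only gains a scalar
  -- factor.
  set l := ∑ i, |Q i i|
  refine ⟨Real.exp (-(t * l)), Real.exp_pos _, fun i j => ?_⟩
  have hB : ∀ i j, 0 ≤ (t • (Q + l • (1 : Matrix ι ι ℝ))) i j := by
    intro i j
    rw [Matrix.smul_apply, Matrix.add_apply, Matrix.smul_apply, Matrix.one_apply]
    refine smul_nonneg ht ?_
    split_ifs with h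
    · subst h
      have h1 : |Q i i| ≤ l :=
        Finset.single_le_sum (f := fun i => |Q i i|) (fun _ _ => abs_nonneg _) (Finset.mem_univ i)
      have h2 := neg_abs_le (Q i i)
      simp only [smul_eq_mul, mul_one]
      linarith
    · simpa using hQ i j h
  have e : t • Q = t • (Q + l • (1 : Matrix ι ι ℝ)) + (-(t * l)) • (1 : Matrix ι ι ℝ) := by
    rw [smul_add, smul_smul, add_assoc, ← add_smul, add_neg_cancel, zero_smul, add_zero]
  rw [e, exp_smul_one_add, Matrix.smul_apply, smul_eq_mul]
  exact mul_le_mul_of_nonneg_left (one_apply_le_exp_apply hB i j) (Real.exp_pos _).le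

end MatrixSemigroup

/-! ### Evolution of the law and the entropy bound. -/

section Flow

variable {n : ℕ} (α β m θ a : ℝ)

/-- The generator at a configuration as a linear functional. -/
noncomputable def genLinear (η : Config n) : (Config n → ℝ) →ₗ[ℝ] ℝ where
  toFun f := gen α β m θ a n f η
  map_add' f g := by
    simp only [gen, genP, genS, genB, Pi.add_apply, add_sub_add_comm, mul_add,
      Finset.sum_add_distrib]
    ring
  map_smul' c f := by
    simp only [gen, genP, genS, genB, Pi.smul_apply, smul_eq_mul, ← mul_sub, mul_left_comm _ c,
      ← Finset.mul_sum, RingHom.id_apply]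
    ring

lemma sum_rateMatrix_mul (f : Config n → ℝ) (η : Config n) :
    ∑ ξ, rateMatrix α β m θ a n η ξ * f ξ = (n : ℝ) ^ 2 * gen α β m θ a n f η := by
  have h := LinearMap.pi_apply_eq_sum_univ (genLinear α β m θ a η) f
  change gen α β m θ a n f η = _ at h
  rw [h, Finset.mul_sum]
  refine Finset.sum_congr rfl fun ξ _ => ?_
  have : (fun j => if ξ = j then (1 : ℝ) else 0) = Pi.single ξ 1 := by
    funext j; rw [Pi.single_apply]; simp only [eq_comm]
  rw [this, rateMatrix, Matrix.of_apply, smul_eq_mul]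
  change _ = (n : ℝ) ^ 2 * (f ξ * gen α β m θ a n (Pi.single ξ 1) η)
  ring

lemma sum_rateMatrix (η : Config n) : ∑ ξ, rateMatrix α β m θ a n η ξ = 0 := by
  have h := sum_rateMatrix_mul α β m θ a (fun _ => 1) η
  simpa [gen, genP, genS, genB] using h

variable {α β m θ a}

lemma rateMatrix_nonneg (hα : α ∈ Set.Ioo (0 : ℝ) 1) (hβ : β ∈ Set.Ioo (0 : ℝ) 1) (hm : 0 < m)
    {η ξ : Config n} (h : η ≠ ξ) : 0 ≤ rateMatrix α β m θ a n η ξ := by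
  have o0 : ∀ x, 0 ≤ occ α β η x := occ_nonneg hα.1.le hβ.1.le η
  have o1 : ∀ x, 0 ≤ 1 - occ α β η x := fun x => sub_nonneg.2 (occ_le_one hα.2.le hβ.2.le η x)
  have hf : ∀ ζ, 0 ≤ (Pi.single ξ (1 : ℝ) : Config n → ℝ) ζ -
      (Pi.single ξ (1 : ℝ) : Config n → ℝ) η := fun ζ => by
    rw [Pi.single_eq_of_ne h, sub_zero, Pi.single_apply]
    split_ifs <;> norm_num
  have hr : ∀ b ∈ Set.Ioo (0 : ℝ) 1, ∀ z, 0 ≤ reservoirRate α β b η z := fun b hb z =>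
    add_nonneg (mul_nonneg hb.1.le (o1 z)) (mul_nonneg (sub_nonneg.2 hb.2.le) (o0 z))
  have ha : ∀ x y, 0 ≤ aRate α β η x y := fun x y => mul_nonneg (o0 x) (o1 y)
  have hmn : 0 ≤ m / (n : ℝ) ^ θ := by positivity
  rw [rateMatrix, Matrix.of_apply, gen]
  refine mul_nonneg (by positivity) (add_nonneg (add_nonneg ?_ ?_) (add_nonneg ?_ ?_))
  · exact Finset.sum_nonneg fun x _ => mul_nonneg (mul_nonneg
      (cRate_nonneg hα.1.le hβ.1.le η x) (add_nonneg (ha _ _) (ha _ _))) (hf _)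
  · exact mul_nonneg (by positivity) (Finset.sum_nonneg fun x _ => mul_nonneg
      (add_nonneg (ha _ _) (ha _ _)) (hf _))
  · exact mul_nonneg (mul_nonneg hmn (hr α hα _)) (hf _)
  · exact mul_nonneg (mul_nonneg hmn (hr β hβ _)) (hf _)

lemma transition_nonneg (hα : α ∈ Set.Ioo (0 : ℝ) 1) (hβ : β ∈ Set.Ioo (0 : ℝ) 1) (hm : 0 < m)
    {t : ℝ} (ht : 0 ≤ t) (η ξ : Config n) : 0 ≤ transition α β m θ a n t η ξ := by
  obtain ⟨r, hr, h⟩ := exists_pos_mul_one_le_exp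
    (fun η ξ h => rateMatrix_nonneg (θ := θ) (a := a) hα hβ hm h) ht
  refine le_trans (mul_nonneg hr.le ?_) (h η ξ)
  rw [Matrix.one_apply]; split_ifs <;> norm_num

variable (α β m θ a) in
/-- The distribution at time `t` of the accelerated process started from `q`. -/
noncomputable def flow (q : Config n → ℝ) (t : ℝ) (ξ : Config n) : ℝ :=
  ∑ η, q η * transition α β m θ a n t η ξ

lemma flow_pos (hα : α ∈ Set.Ioo (0 : ℝ) 1) (hβ : β ∈ Set.Ioo (0 : ℝ) 1) (hm : 0 < m)
    {q : Config n → ℝ} (hq : ∀ η, 0 < q η) {t : ℝ} (ht : 0 ≤ t) (ξ : Config n) :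
    0 < flow α β m θ a q t ξ := by
  obtain ⟨r, hr, h⟩ := exists_pos_mul_one_le_exp
    (fun η ξ h => rateMatrix_nonneg (θ := θ) (a := a) hα hβ hm h) ht
  refine Finset.sum_pos' (fun η _ => mul_nonneg (hq η).le (transition_nonneg hα hβ hm ht η ξ))
    ⟨ξ, Finset.mem_univ ξ, mul_pos (hq ξ) ?_⟩
  have := h ξ ξ
  rw [Matrix.one_apply_eq, mul_one] at this
  exact hr.trans_le this

variable (α β m θ a) in
lemma hasDerivAt_flow (q : Config n → ℝ) (t : ℝ) (ξ : Config n) :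
    HasDerivAt (fun t => flow α β m θ a q t ξ)
      (∑ η, flow α β m θ a q t η * rateMatrix α β m θ a n η ξ) t := by
  have h : HasDerivAt (fun t => flow α β m θ a q t ξ)
      (∑ η, q η * (transition α β m θ a n t * rateMatrix α β m θ a n) η ξ) t :=
    HasDerivAt.fun_sum fun η _ => (hasDerivAt_exp_smul_apply _ η ξ t).const_mul (q η)
  convert h using 1
  simp only [flow, Matrix.mul_apply, Finset.sum_mul, Finset.mul_sum]
  rw [Finset.sum_comm]
  exact Finset.sum_congr rfl fun η _ => Finset.sum_congr rfl fun ζ _ => by ring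

variable (α β m θ a) in
lemma sum_deriv_flow_mul (q f : Config n → ℝ) (t : ℝ) :
    ∑ ξ, (∑ η, flow α β m θ a q t η * rateMatrix α β m θ a n η ξ) * f ξ =
      (n : ℝ) ^ 2 * ∑ η, flow α β m θ a q t η * gen α β m θ a n f η := by
  simp only [Finset.sum_mul, mul_assoc]
  rw [Finset.sum_comm]
  simp only [← Finset.mul_sum, sum_rateMatrix_mul]
  rw [Finset.mul_sum]
  exact Finset.sum_congr rfl fun η _ => by ring

variable (α β m θ a) in
lemma flow_zero (q : Config n → ℝ) : flow α β m θ a q 0 = q := by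
  funext ξ
  simp [flow, transition, Matrix.one_apply]

variable (α β m θ a) in
lemma sum_deriv_flow (q : Config n → ℝ) (t : ℝ) :
    ∑ ξ, ∑ η, flow α β m θ a q t η * rateMatrix α β m θ a n η ξ = 0 := by
  rw [Finset.sum_comm]
  simp only [← Finset.mul_sum, sum_rateMatrix, mul_zero, Finset.sum_const_zero]

variable (α β m θ a) in
lemma sum_flow (q : Config n → ℝ) (t : ℝ) : ∑ ξ, flow α β m θ a q t ξ = ∑ ξ, q ξ := by
  have hd : ∀ t, HasDerivAt (fun t => ∑ ξ, flow α β m θ a q t ξ) 0 t := fun t => by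
    have h : HasDerivAt (fun t => ∑ ξ, flow α β m θ a q t ξ) _ t :=
      HasDerivAt.fun_sum fun ξ _ => hasDerivAt_flow α β m θ a q t ξ
    rwa [sum_deriv_flow] at h
  have h := is_const_of_deriv_eq_zero (fun t => (hd t).differentiableAt) (fun t => (hd t).deriv) t 0
  rw [h, flow_zero]

lemma isProb_flow (hα : α ∈ Set.Ioo (0 : ℝ) 1) (hβ : β ∈ Set.Ioo (0 : ℝ) 1) (hm : 0 < m)
    {q : Config n → ℝ} (hq : IsProb q) (hpos : ∀ η, 0 < q η) {t : ℝ} (ht : 0 ≤ t) :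
    IsProb (flow α β m θ a q t) :=
  ⟨fun η => (flow_pos hα hβ hm hpos ht η).le, (sum_flow α β m θ a q t).trans hq.sum_eq⟩

variable (α β) in
/-- The relative entropy of `p` with respect to the slowly varying product measure, up to a
constant. -/
noncomputable def relEntropy (p : Config n → ℝ) : ℝ := ∑ η, p η * logDensity α β p η

lemma card_config_le (n : ℕ) : (Fintype.card (Config n) : ℝ) ≤ 2 ^ n := by
  rw [Fintype.card_fun, Fintype.card_bool, Fintype.card_coe, Nat.card_Ioo]
  push_cast
  exact pow_le_pow_right₀ one_le_two (by omega)

/-- The entropy ∑ p log p lies between minus the logarithm of the number of configurations and 0.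
The weight is not normalised; its constant would cancel in differences in time. -/
lemma abs_relEntropy_le (hn : 3 ≤ n) {p : Config n → ℝ} (hp : IsProb p) (hpos : ∀ η, 0 < p η) :
    |relEntropy α β p| ≤ n * (1 + (|Real.log (α / (1 - α))| + |Real.log (β / (1 - β))|)) := by
  set u := Real.log (α / (1 - α))
  set v := Real.log (β / (1 - β))
  have hle1 : ∀ η, p η ≤ 1 := fun η => by
    rw [← hp.sum_eq]
    exact Finset.single_le_sum (fun ξ _ => hp.nonneg ξ) (Finset.mem_univ η)
  have h1 : |∑ η, p η * logWeight u v η| ≤ n * (|u| + |v|) := by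
    refine (Finset.abs_sum_le_sum_abs _ _).trans ?_
    calc _ ≤ ∑ η, p η * (n * (|u| + |v|)) := Finset.sum_le_sum fun η _ => by
          rw [abs_mul, abs_of_nonneg (hp.nonneg η)]
          exact mul_le_mul_of_nonneg_left (abs_logWeight_le hn u v η) (hp.nonneg η)
      _ = _ := by rw [← Finset.sum_mul, hp.sum_eq, one_mul]
  have h2 : ∑ η, p η * Real.log (p η) ≤ 0 := Finset.sum_nonpos fun η _ =>
    mul_nonpos_of_nonneg_of_nonpos (hp.nonneg η) (Real.log_nonpos (hp.nonneg η) (hle1 η))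
  have h3 : -(n : ℝ) ≤ ∑ η, p η * Real.log (p η) := by
    set N : ℝ := (Fintype.card (Config n) : ℝ) with hN
    have hNpos : 0 < N := by rw [hN]; exact_mod_cast Fintype.card_pos
    -- Gibbs' inequality against the uniform law, term by term: log z ≤ z - 1 at z = 1/(p N).
    have h4 : ∀ η, p η * -Real.log N - (1 / N - p η) ≤ p η * Real.log (p η) := by
      intro η
      have h5 := Real.log_le_sub_one_of_pos (div_pos one_pos (mul_pos (hpos η) hNpos))
      rw [Real.log_div one_ne_zero (mul_pos (hpos η) hNpos).ne', Real.log_one,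
        Real.log_mul (hpos η).ne' hNpos.ne'] at h5
      have h6 := mul_le_mul_of_nonneg_left h5 (hp.nonneg η)
      have h7 : p η * (1 / (p η * N)) = 1 / N := by
        have := (hpos η).ne'
        field_simp
      linarith
    have h5 := Finset.sum_le_sum fun η (_ : η ∈ Finset.univ) => h4 η
    rw [Finset.sum_sub_distrib, Finset.sum_sub_distrib, ← Finset.sum_mul, hp.sum_eq,
      Finset.sum_const, Finset.card_univ, nsmul_eq_mul, ← hN, mul_one_div_cancel hNpos.ne'] at h5
    have h6 : Real.log N ≤ n := by
      have h7 := Real.log_le_log hNpos (card_config_le n)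
      rw [Real.log_pow] at h7
      have h8 : Real.log 2 ≤ 1 := by linarith [Real.log_two_lt_d9]
      exact h7.trans (mul_le_of_le_one_right (by positivity) h8)
    linarith
  have e : relEntropy α β p = ∑ η, p η * Real.log (p η) - ∑ η, p η * logWeight u v η := by
    simp only [relEntropy, logDensity, mul_sub, Finset.sum_sub_distrib, u, v]
  have hn0 : (0 : ℝ) ≤ n := by positivity
  rw [e]
  rw [abs_le] at *
  constructor <;> linarith [h1.1, h1.2]

/-- Differentiating the logarithm contributes ∑ p · (p'/p) = ∑ p' = 0, by conservation of mass. -/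
lemma hasDerivAt_relEntropy_flow (hα : α ∈ Set.Ioo (0 : ℝ) 1) (hβ : β ∈ Set.Ioo (0 : ℝ) 1)
    (hm : 0 < m) {q : Config n → ℝ} (hq : ∀ η, 0 < q η) {t : ℝ} (ht : 0 ≤ t) :
    HasDerivAt (fun t => relEntropy α β (flow α β m θ a q t))
      (∑ ξ, (∑ η, flow α β m θ a q t η * rateMatrix α β m θ a n η ξ) *
        logDensity α β (flow α β m θ a q t) ξ) t := by
  have hpos := flow_pos (θ := θ) (a := a) hα hβ hm hq ht
  have h : HasDerivAt (fun t => relEntropy α β (flow α β m θ a q t)) _ t :=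
    HasDerivAt.fun_sum fun ξ _ => (hasDerivAt_flow α β m θ a q t ξ).fun_mul
      (((hasDerivAt_flow α β m θ a q t ξ).log (hpos ξ).ne').sub_const
        (logWeight (Real.log (α / (1 - α))) (Real.log (β / (1 - β))) ξ))
  convert h using 1
  rw [Finset.sum_add_distrib]
  have : ∑ ξ, flow α β m θ a q t ξ *
      ((∑ η, flow α β m θ a q t η * rateMatrix α β m θ a n η ξ) / flow α β m θ a q t ξ) = 0 := by
    rw [← sum_deriv_flow α β m θ a q t]
    exact Finset.sum_congr rfl fun ξ _ => mul_div_cancel₀ _ (hpos ξ).ne'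
  rw [this, add_zero]

/-- Entropy bound on the time-integrated Dirichlet forms: they are dominated by a continuous
function of time whose integral is of order `n`. -/
theorem exists_energy_bound (hα : α ∈ Set.Ioo (0 : ℝ) 1) (hβ : β ∈ Set.Ioo (0 : ℝ) 1)
    (hm : 0 < m) (ha : a ≤ 2) (hn : 3 ≤ n) {q : Config n → ℝ} (hq : IsProb q)
    (hpos : ∀ η, 0 < q η) {t : ℝ} (ht : 0 ≤ t) :
    ∃ φ : ℝ → ℝ, ContinuousOn φ (Set.Icc 0 t) ∧
      (∀ s ∈ Set.Icc 0 t, (n : ℝ) ^ 2 * (energyP α β (flow α β m θ a q s) +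
        (n : ℝ) ^ (a - 2) * energyS (flow α β m θ a q s)) ≤ φ s) ∧
      ∫ s in (0 : ℝ)..t, φ s ≤
        n * (4 * (1 + (|Real.log (α / (1 - α))| + |Real.log (β / (1 - β))|)) +
          36 * (Real.log (β / (1 - β)) - Real.log (α / (1 - α))) ^ 2 * t) := by
  have hn' : (3 : ℝ) ≤ n := by exact_mod_cast hn
  set C := 18 * (Real.log (β / (1 - β)) - Real.log (α / (1 - α))) ^ 2 with hC
  set H' : ℝ → ℝ := fun t => ∑ ξ, (∑ η, flow α β m θ a q t η * rateMatrix α β m θ a n η ξ) *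
    logDensity α β (flow α β m θ a q t) ξ with hH'
  have hcont : ∀ η, Continuous fun s => flow α β m θ a q s η := fun η =>
    continuous_iff_continuousAt.2 fun s => (hasDerivAt_flow α β m θ a q s η).continuousAt
  have hH'c : ContinuousOn H' (Set.Icc 0 t) := by
    refine continuousOn_finsetSum _ fun ξ _ => ContinuousOn.mul ?_ ?_
    · exact (continuous_finsetSum _ fun η _ => (hcont η).mul continuous_const).continuousOn
    · exact ((hcont ξ).continuousOn.log fun s hs =>
        (flow_pos hα hβ hm hpos hs.1 ξ).ne').sub continuousOn_const
  -- The dissipation inequality solved for the energies. The majorant is continuous, and the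
  -- integral of H' is an entropy difference.
  refine ⟨fun s => 2 * (-H' s + n * C), ?_, ?_, ?_⟩
  · exact continuousOn_const.mul (hH'c.neg.add continuousOn_const)
  · intro s hs
    have h := sum_mul_gen_logDensity_le (θ := θ) (m := m) hα hβ hm ha hn
      (isProb_flow (θ := θ) (a := a) hα hβ hm hq hpos hs.1) (flow_pos hα hβ hm hpos hs.1)
    have e : H' s = _ := sum_deriv_flow_mul α β m θ a q _ s
    have h2 := mul_le_mul_of_nonneg_left h (by positivity : (0 : ℝ) ≤ (n : ℝ) ^ 2)
    rw [← e] at h2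
    have e2 : (n : ℝ) ^ 2 * (C / n) = n * C := by field_simp
    rw [mul_add, e2] at h2
    linarith
  · have hint : IntervalIntegrable H' volume 0 t :=
      ContinuousOn.intervalIntegrable (by rwa [Set.uIcc_of_le ht])
    have hI : ∫ s in (0 : ℝ)..t, H' s =
        relEntropy α β (flow α β m θ a q t) - relEntropy α β (flow α β m θ a q 0) :=
      intervalIntegral.integral_eq_sub_of_hasDerivAt (fun s hs => by
        rw [Set.uIcc_of_le ht] at hs
        exact hasDerivAt_relEntropy_flow hα hβ hm hpos hs.1) hint
    rw [intervalIntegral.integral_const_mul, intervalIntegral.integral_add (f := fun s => -H' s)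
      hint.neg intervalIntegrable_const, intervalIntegral.integral_neg, hI, intervalIntegral.integral_const]
    have b0 := abs_relEntropy_le (α := α) (β := β) hn
      (isProb_flow (θ := θ) (a := a) hα hβ hm hq hpos le_rfl) (flow_pos hα hβ hm hpos le_rfl)
    have b1 := abs_relEntropy_le (α := α) (β := β) hn
      (isProb_flow (θ := θ) (a := a) hα hβ hm hq hpos ht) (flow_pos hα hβ hm hpos ht)
    rw [abs_le] at b0 b1
    rw [smul_eq_mul]
    linarith [b0.2, b1.1]

end Flow

/-! ### From path expectations to one-time marginals. -/

section PathLaw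

variable {n : ℕ} {α β m θ a T : ℝ}

/-- Joint measurability of the evaluation map, from right-continuity of the trajectories. -/
lemma measurable_eval (hT : 0 < T) :
    Measurable fun z : PathSpace T n × ℝ => z.1.1 (Set.projIcc 0 T hT.le z.2) := by
  have hcoord : ∀ s : Set.Icc (0 : ℝ) T, Measurable fun ω : PathSpace T n => ω.1 s := fun s =>
    (measurable_pi_apply s).comp measurable_subtype_coe
  -- The time is approximated by grid points from above, so right-continuity gives the limit; `⌊·⌋ +
  -- 1` guarantees the correct side.
  refine measurable_of_tendsto_metrizable (f := fun (k : ℕ) (z : PathSpace T n × ℝ) =>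
    z.1.1 (Set.projIcc 0 T hT.le (((⌊z.2 * (k + 1)⌋ : ℝ) + 1) / (k + 1)))) ?_ ?_
  · intro k
    have h1 : Measurable fun z : PathSpace T n × ℤ =>
        z.1.1 (Set.projIcc 0 T hT.le (((z.2 : ℝ) + 1) / (k + 1))) :=
      measurable_from_prod_countable_left fun j =>
        hcoord (Set.projIcc 0 T hT.le (((j : ℝ) + 1) / (k + 1)))
    exact h1.comp (measurable_fst.prodMk
      (Int.measurable_floor.comp (measurable_snd.mul_const ((k : ℝ) + 1))))
  · rw [tendsto_pi_nhds]
    rintro ⟨ω, s⟩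
    have hle : ∀ k : ℕ, s ≤ ((⌊s * (k + 1)⌋ : ℝ) + 1) / (k + 1) := fun k => by
      rw [le_div_iff₀ (by positivity)]
      exact (Int.lt_floor_add_one _).le
    have hge : ∀ k : ℕ, ((⌊s * (k + 1)⌋ : ℝ) + 1) / (k + 1) ≤ s + 1 / ((k : ℝ) + 1) := fun k => by
      have hk : (0 : ℝ) < k + 1 := by positivity
      rw [div_le_iff₀ hk, add_mul, one_div_mul_cancel hk.ne']
      linarith [Int.floor_le (s * ((k : ℝ) + 1))]
    have hlim : Tendsto (fun k : ℕ => ((⌊s * (k + 1)⌋ : ℝ) + 1) / (k + 1)) atTop (𝓝 s) := by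
      refine tendsto_of_tendsto_of_tendsto_of_le_of_le tendsto_const_nhds ?_ hle hge
      simpa using (tendsto_const_nhds (x := s)).add
        (tendsto_one_div_add_atTop_nhds_zero_nat (𝕜 := ℝ))
    refine ((ω.2 (Set.projIcc 0 T hT.le s)).1.tendsto).comp
      (tendsto_nhdsWithin_iff.2 ⟨?_, Eventually.of_forall fun k => ?_⟩)
    · exact (continuous_projIcc.tendsto s).comp hlim
    · exact Set.monotone_projIcc hT.le (hle k)

variable {μ : Measure (Config n)} {P : Measure (PathSpace T n)}

/-- The two-time distribution at times 0 and s, summed over the initial configuration. An upper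
bound is all that is used later. -/
lemma IsLaw.measure_eq_le (hP : IsLaw α β m θ a T n μ P) (hα : α ∈ Set.Ioo (0 : ℝ) 1)
    (hβ : β ∈ Set.Ioo (0 : ℝ) 1) (hm : 0 < m) (hT : 0 < T) (s : Set.Icc (0 : ℝ) T)
    (η : Config n) :
    P {ω | ω.1 s = η} ≤ ENNReal.ofReal (flow α β m θ a (fun ξ => μ.real {ξ}) s η) := by
  have hz : (0 : ℝ) ∈ Set.Icc 0 T := ⟨le_rfl, hT.le⟩
  have hsub : {ω : PathSpace T n | ω.1 s = η} ⊆
      ⋃ ξ, {ω | ∀ i, ω.1 ((![⟨0, hz⟩, s] : Fin 2 → Set.Icc (0 : ℝ) T) i) =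
        (![ξ, η] : Fin 2 → Config n) i} := by
    intro ω hω
    refine Set.mem_iUnion.2 ⟨ω.1 ⟨0, hz⟩, fun i => ?_⟩
    fin_cases i
    · rfl
    · exact hω
  refine (measure_mono hsub).trans ((measure_iUnion_fintype_le P _).trans (le_of_eq ?_))
  rw [flow, ENNReal.ofReal_sum_of_nonneg fun ξ _ => mul_nonneg measureReal_nonneg
    (transition_nonneg hα hβ hm s.2.1 ξ η)]
  refine Finset.sum_congr rfl fun ξ _ => ?_
  have hmono : Monotone (![⟨0, hz⟩, s] : Fin 2 → Set.Icc (0 : ℝ) T) := by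
    rw [Fin.monotone_iff_le_succ]
    intro i
    fin_cases i
    exact Subtype.coe_le_coe.1 s.2.1
  rw [hP 1 ![⟨0, hz⟩, s] ![ξ, η] hmono rfl]
  simp

lemma IsLaw.isFiniteMeasure (hP : IsLaw α β m θ a T n μ P) (hα : α ∈ Set.Ioo (0 : ℝ) 1)
    (hβ : β ∈ Set.Ioo (0 : ℝ) 1) (hm : 0 < m) (hT : 0 < T) : IsFiniteMeasure P := by
  refine ⟨?_⟩
  have hsub : (Set.univ : Set (PathSpace T n)) ⊆
      ⋃ η, {ω | ω.1 (⟨0, le_rfl, hT.le⟩ : Set.Icc (0 : ℝ) T) = η} :=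
    fun ω _ => Set.mem_iUnion.2 ⟨_, rfl⟩
  refine (measure_mono hsub).trans_lt ((measure_iUnion_fintype_le P _).trans_lt ?_)
  exact ENNReal.sum_lt_top.2 fun η _ =>
    (hP.measure_eq_le hα hβ hm hT _ η).trans_lt ENNReal.ofReal_lt_top

variable (μ) in
/-- The average of `μ` and the uniform measure. -/
noncomputable def mixture (ξ : Config n) : ℝ :=
  (μ.real {ξ} + 1 / Fintype.card (Config n)) / 2

variable (μ) in
lemma mixture_pos (ξ : Config n) : 0 < mixture μ ξ := by
  have h1 : (0 : ℝ) < Fintype.card (Config n) := by exact_mod_cast Fintype.card_pos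
  have h2 : 0 ≤ μ.real {ξ} := measureReal_nonneg
  unfold mixture; positivity

variable (μ) in
lemma isProb_mixture [IsProbabilityMeasure μ] : IsProb (mixture μ) := by
  refine ⟨fun ξ => (mixture_pos μ ξ).le, ?_⟩
  have h1 : (Fintype.card (Config n) : ℝ) ≠ 0 := by
    have : 0 < Fintype.card (Config n) := Fintype.card_pos
    positivity
  have h2 : ∑ ξ, μ.real {ξ} = 1 := by
    rw [sum_measureReal_singleton]; simp
  simp only [mixture]
  rw [← Finset.sum_div, Finset.sum_add_distrib, h2, Finset.sum_const, Finset.card_univ,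
    nsmul_eq_mul, mul_one_div_cancel h1]
  norm_num

/-- For a factor 2, an arbitrary initial law is traded for a strictly positive one, as required by
the logarithms in the entropy argument. -/
lemma flow_le_two_mul (hα : α ∈ Set.Ioo (0 : ℝ) 1) (hβ : β ∈ Set.Ioo (0 : ℝ) 1) (hm : 0 < m)
    {s : ℝ} (hs : 0 ≤ s) (η : Config n) :
    flow α β m θ a (fun ξ => μ.real {ξ}) s η ≤ 2 * flow α β m θ a (mixture μ) s η := by
  rw [flow, flow, Finset.mul_sum]
  refine Finset.sum_le_sum fun ξ _ => ?_
  rw [← mul_assoc]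
  refine mul_le_mul_of_nonneg_right ?_ (transition_nonneg hα hβ hm hs ξ η)
  have : (0 : ℝ) ≤ 1 / Fintype.card (Config n) := by positivity
  rw [mixture]; linarith

/-- The time-integrated functional is controlled by the one-time marginals. -/
lemma IsLaw.lintegral_abs_integral_le (hP : IsLaw α β m θ a T n μ P)
    (hα : α ∈ Set.Ioo (0 : ℝ) 1) (hβ : β ∈ Set.Ioo (0 : ℝ) 1) (hm : 0 < m) (hT : 0 < T) {t : ℝ}
    (ht : t ∈ Set.Icc 0 T) {V : ℝ → Config n → ℝ}
    (hV : ∀ η, AEMeasurable (fun s => V s η) (volume.restrict (Set.Icc 0 T))) :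
    ∫⁻ ω, ENNReal.ofReal |∫ s in (0 : ℝ)..t, V s (ω.1 (Set.projIcc 0 T hT.le s))| ∂P ≤
      ∫⁻ s in Set.Ioc 0 t,
        ENNReal.ofReal (∑ η, 2 * flow α β m θ a (mixture μ) s η * |V s η|) := by
  have hfin := hP.isFiniteMeasure hα hβ hm hT
  have hsub : Set.Ioc 0 t ⊆ Set.Icc 0 T := fun s hs => ⟨hs.1.le, hs.2.trans ht.2⟩
  have hV' : ∀ η, AEMeasurable (fun s => V s η) (volume.restrict (Set.Ioc 0 t)) := fun η =>
    (hV η).mono_measure (Measure.restrict_mono hsub le_rfl)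
  have hset : ∀ η, MeasurableSet {z : PathSpace T n × ℝ |
      z.1.1 (Set.projIcc 0 T hT.le z.2) = η} := fun η =>
    measurable_eval hT (measurableSet_singleton η)
  -- Expanding over the finitely many configurations separates the dependence on time from that on
  -- the path; this gives the joint measurability needed for Tonelli.
  have hexp : ∀ s (ω : PathSpace T n),
      ENNReal.ofReal |V s (ω.1 (Set.projIcc 0 T hT.le s))| = ∑ η, ENNReal.ofReal |V s η| *
        {z : PathSpace T n × ℝ | z.1.1 (Set.projIcc 0 T hT.le z.2) = η}.indicator 1 (ω, s) := by
    intro s ω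
    rw [Finset.sum_eq_single (ω.1 (Set.projIcc 0 T hT.le s))]
    · simp
    · intro η _ hη
      rw [Set.indicator_of_notMem (fun h => hη h.symm), mul_zero]
    · intro h
      exact absurd (Finset.mem_univ _) h
  calc _ ≤ ∫⁻ ω, (∫⁻ s in Set.Ioc 0 t,
        ENNReal.ofReal |V s (ω.1 (Set.projIcc 0 T hT.le s))|) ∂P := by
        refine lintegral_mono fun ω => ?_
        rw [intervalIntegral.integral_of_le ht.1]
        simp only [← Real.norm_eq_abs, ofReal_norm]
        exact enorm_integral_le_lintegral_enorm _
    _ = ∫⁻ s in Set.Ioc 0 t, (∫⁻ ω,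
        ENNReal.ofReal |V s (ω.1 (Set.projIcc 0 T hT.le s))| ∂P) := by
        refine lintegral_lintegral_swap ?_
        simp only [Function.uncurry_def, hexp]
        refine Finset.aemeasurable_fun_sum _ fun η _ => AEMeasurable.mul ?_ ?_
        · have : AEMeasurable (fun s => ENNReal.ofReal |V s η|) (volume.restrict (Set.Ioc 0 t)) :=
            (hV' η).abs.ennreal_ofReal
          exact this.comp_snd
        · exact ((measurable_one.indicator (hset η)).comp
            (measurable_fst.prodMk measurable_snd)).aemeasurable
    _ ≤ _ := by
        refine setLIntegral_mono' measurableSet_Ioc fun s hs => ?_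
        have hs0 : (0 : ℝ) ≤ s := hs.1.le
        have hproj : ((Set.projIcc 0 T hT.le s : Set.Icc (0 : ℝ) T) : ℝ) = s := by
          rw [Set.projIcc_of_mem hT.le (hsub hs)]
        simp only [hexp]
        have hm1 : ∀ η, Measurable fun ω : PathSpace T n =>
            {z : PathSpace T n × ℝ | z.1.1 (Set.projIcc 0 T hT.le z.2) = η}.indicator
              (1 : PathSpace T n × ℝ → ENNReal) (ω, s) := fun η =>
          (measurable_one.indicator (hset η)).comp (measurable_id.prodMk measurable_const)
        rw [lintegral_finsetSum _ fun η _ => (hm1 η).const_mul _,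
          ENNReal.ofReal_sum_of_nonneg fun η _ => mul_nonneg (mul_nonneg zero_le_two
            (flow_pos hα hβ hm (mixture_pos μ) hs0 η).le) (abs_nonneg _)]
        refine Finset.sum_le_sum fun η _ => ?_
        rw [lintegral_const_mul _ (hm1 η)]
        have e : ∫⁻ ω, {z : PathSpace T n × ℝ | z.1.1 (Set.projIcc 0 T hT.le z.2) = η}.indicator
              (1 : PathSpace T n × ℝ → ENNReal) (ω, s) ∂P =
            P {ω | ω.1 (Set.projIcc 0 T hT.le s) = η} := by
          rw [← lintegral_indicator_one]
          · rfl
          · exact hset η |>.preimage (measurable_id.prodMk measurable_const)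
        rw [e, mul_comm, ENNReal.ofReal_mul (mul_nonneg zero_le_two
          (flow_pos hα hβ hm (mixture_pos μ) hs0 η).le)]
        gcongr
        refine (hP.measure_eq_le hα hβ hm hT _ η).trans (ENNReal.ofReal_le_ofReal ?_)
        rw [hproj]
        exact flow_le_two_mul hα hβ hm hs0 η

end PathLaw

/-! ### Quantitative bound on the expected error. -/

section Assembly

variable {n : ℕ} {α β m θ a T : ℝ} {μ : Measure (Config n)} {P : Measure (PathSpace T n)}

variable (α β) in
/-- The constant in the entropy bound. -/
noncomputable def entropyConst (t : ℝ) : ℝ :=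
  4 * (1 + (|Real.log (α / (1 - α))| + |Real.log (β / (1 - β))|)) +
    36 * (Real.log (β / (1 - β)) - Real.log (α / (1 - α))) ^ 2 * t

variable (α β a) in
/-- The bound on the expected replacement error. -/
noncomputable def errorBound (M t δ ε : ℝ) (L : ℕ) (n : ℕ) : ℝ :=
  δ * t + 1 / δ * (M ^ 2 * (t * (2 / (L + 1) + L / n +
    (8 * L + 12) * L * (2 / (n : ℝ) ^ (a - 1) + 8 / n) + 120 * (L + 1) * (2 * ε + 1 / n)) +
    entropyConst α β t * ((8 * L + 12) * L / (2 * n) + 6 * (L + 1) * (2 * ε + 1 / n))))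

lemma aemeasurable_replacementError {M : ℝ} {G : ℝ → ℝ → ℝ} (hG : IsTest T M G) (ε : ℝ)
    (η : Config n) : AEMeasurable (fun s => replacementError α β ε (G s) η)
      (volume.restrict (Set.Icc 0 T)) := by
  unfold replacementError
  refine AEMeasurable.const_mul ?_ _
  refine Finset.aemeasurable_fun_sum _ fun x hx => AEMeasurable.mul_const (hG.1 _ ⟨?_, ?_⟩) _
  · positivity
  · rw [innerBulk, Finset.mem_Icc] at hx
    exact div_le_one_of_le₀ (by exact_mod_cast by omega) (by positivity)

/-- The bound does not depend on the test function, the initial law or the path measure; hence the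
uniformity in the theorem. -/
theorem expectedError_le [IsProbabilityMeasure μ] (hP : IsLaw α β m θ a T n μ P)
    (hα : α ∈ Set.Ioo (0 : ℝ) 1) (hβ : β ∈ Set.Ioo (0 : ℝ) 1) (hm : 0 < m) (ha : a ≤ 2)
    (hT : 0 < T) (hn : 3 ≤ n) {t : ℝ} (ht : t ∈ Set.Icc 0 T) {M δ ε : ℝ} (hM : 0 ≤ M)
    (hδ : 0 < δ) (hε : 0 ≤ ε) {L : ℕ} (hL : 1 ≤ L) (hLn : L ≤ ⌊ε * n⌋₊) {G : ℝ → ℝ → ℝ}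
    (hG : IsTest T M G) :
    expectedError α β hT P ε t G ≤ ENNReal.ofReal (errorBound α β a M t δ ε L n) := by
  have hn' : (0 : ℝ) < n := by positivity
  set p : ℝ → Config n → ℝ := flow α β m θ a (mixture μ) with hp
  obtain ⟨φ, hφc, hφ, hφI⟩ := exists_energy_bound (θ := θ) hα hβ hm ha hn (isProb_mixture μ)
    (mixture_pos μ) ht.1
  set ℓ := ⌊ε * n⌋₊ with hℓ
  have hℓn : (2 * (ℓ : ℝ) + 1) / n ≤ 2 * ε + 1 / n := by
    have : (ℓ : ℝ) ≤ ε * n := Nat.floor_le (by positivity)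
    rw [div_le_iff₀ hn', add_mul, one_div_mul_cancel hn'.ne']
    linarith
  set c₁ := 2 / ((L : ℝ) + 1) + L / n + (8 * L + 12) * L * (2 / (n : ℝ) ^ (a - 1) + 8 / n) +
    120 * (L + 1) * (2 * ε + 1 / n) with hc₁
  set c₂ := (8 * (L : ℝ) + 12) * L / (2 * n) + 6 * (L + 1) * (2 * ε + 1 / n) with hc₂
  have hc₂0 : 0 ≤ c₂ := by positivity
  have key : ∀ s ∈ Set.Icc 0 t, ∑ η, 2 * p s η * |replacementError α β ε (G s) η| ≤
      δ + 1 / δ * (M ^ 2 * (c₁ + c₂ * (φ s / n))) := by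
    intro s hs
    have hprob : IsProb (p s) := isProb_flow hα hβ hm (isProb_mixture μ) (mixture_pos μ) hs.1
    -- Young parameter for exclusion moves: n^(a-1) = n · n^(a-2) turns the energy term into half of
    -- n^(a-2) `energyS`, which the entropy bound controls, while 2/n^(a-1) → 0 because a > 1.
    have hB : 0 < (n : ℝ) ^ (a - 1) := by positivity
    have hst := sum_mul_boxError_sq_le (g := fun x => G s ((x : ℝ) / n)) hα.1.le hβ.1.le hprob
      (by omega) hB hL hLn hM (fun x hx => by
        rw [Finset.mem_Icc] at hx
        refine hG.2 s ⟨hs.1, hs.2.trans ht.2⟩ _ ⟨by positivity, ?_⟩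
        exact div_le_one_of_le₀ (by exact_mod_cast by omega) (by positivity))
    have hEP : 0 ≤ energyP α β (p s) := Finset.sum_nonneg fun b _ =>
      bondEnergy_nonneg (fun η => cRate_nonneg hα.1.le hβ.1.le η b) _ b
    have hES : 0 ≤ energyS (p s) := Finset.sum_nonneg fun b _ =>
      bondEnergy_nonneg (fun _ => zero_le_one) _ b
    have hpow : (n : ℝ) ^ (a - 1) = (n : ℝ) ^ (a - 2) * n := by
      rw [← Real.rpow_add_one hn'.ne']; congr 1; ring
    change _ ≤ M ^ 2 * (2 / ((L : ℝ) + 1) + L / n + (8 * L + 12) * L *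
      ((n : ℝ) ^ (a - 1) / 2 * energyS (p s) / n + 2 / (n : ℝ) ^ (a - 1) + 8 / n) +
      12 * (L + 1) * ((2 * ℓ + 1) / n) * (n / 2 * energyP α β (p s) + 10)) at hst
    have hφs : n * (energyP α β (p s) + (n : ℝ) ^ (a - 2) * energyS (p s)) ≤ φ s / n := by
      rw [le_div_iff₀ hn']
      refine le_trans (le_of_eq ?_) (hφ s hs)
      ring
    have hV2 : ∑ η, p s η * replacementError α β ε (G s) η ^ 2 ≤
        M ^ 2 * (c₁ + c₂ * (φ s / n)) := by
      simp only [replacementError_eq α β ε _ _ (hL.trans hLn)]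
      refine hst.trans (mul_le_mul_of_nonneg_left ?_ (sq_nonneg M))
      refine le_trans ?_ (add_le_add le_rfl (mul_le_mul_of_nonneg_left hφs hc₂0))
      have e1 : (n : ℝ) ^ (a - 1) / 2 * energyS (p s) / n = (n : ℝ) ^ (a - 2) * energyS (p s) / 2 := by
        rw [hpow]; field_simp
      have hX : 0 ≤ (n : ℝ) ^ (a - 2) * energyS (p s) := mul_nonneg (by positivity) hES
      set X := (n : ℝ) ^ (a - 2) * energyS (p s)
      set Y := energyP α β (p s)
      rw [e1]
      have e2 : c₂ * (n * (Y + X)) = (8 * L + 12) * L * (X / 2) + (8 * L + 12) * L * Y / 2 +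
          12 * (L + 1) * (2 * ε + 1 / n) * (n / 2 * Y) +
          6 * (L + 1) * (2 * ε + 1 / n) * (n * X) := by
        rw [hc₂]; field_simp; ring
      have e3 : 12 * ((L : ℝ) + 1) * ((2 * ℓ + 1) / n) * (n / 2 * Y + 10) ≤
          12 * ((L : ℝ) + 1) * (2 * ε + 1 / n) * (n / 2 * Y + 10) := by
        gcongr
      have e4 : 0 ≤ (8 * (L : ℝ) + 12) * L * Y / 2 := by positivity
      have e5 : 0 ≤ 6 * ((L : ℝ) + 1) * (2 * ε + 1 / n) * (n * X) := by positivity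
      rw [e2, hc₁]
      linarith
    calc _ ≤ ∑ η, (p s η * δ + 1 / δ * (p s η * replacementError α β ε (G s) η ^ 2)) := by
          refine Finset.sum_le_sum fun η _ => ?_
          set v := replacementError α β ε (G s) η
          have h1 : 2 * |v| ≤ δ + 1 / δ * v ^ 2 := by
            have h2 : 0 ≤ 1 / δ * (|v| - δ) ^ 2 := by positivity
            have h3 : 1 / δ * (|v| - δ) ^ 2 = 1 / δ * v ^ 2 - 2 * |v| + δ := by
              rw [← sq_abs v]; field_simp; ring
            linarith
          have h4 := mul_le_mul_of_nonneg_left h1 (hprob.nonneg η)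
          linarith
      _ = δ + 1 / δ * ∑ η, p s η * replacementError α β ε (G s) η ^ 2 := by
          rw [Finset.sum_add_distrib, ← Finset.sum_mul, hprob.sum_eq, one_mul, ← Finset.mul_sum]
      _ ≤ _ := by gcongr
  have hψc : ContinuousOn (fun s => δ + 1 / δ * (M ^ 2 * (c₁ + c₂ * (φ s / n))))
      (Set.Icc 0 t) := by fun_prop
  have hφint : IntervalIntegrable φ volume 0 t :=
    ContinuousOn.intervalIntegrable (by rwa [Set.uIcc_of_le ht.1])
  have hψint : IntegrableOn (fun s => δ + 1 / δ * (M ^ 2 * (c₁ + c₂ * (φ s / n))))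
      (Set.Ioc 0 t) :=
    (hψc.integrableOn_Icc).mono_set Set.Ioc_subset_Icc_self
  have hpos : ∀ s ∈ Set.Icc 0 t, 0 ≤ ∑ η, 2 * p s η * |replacementError α β ε (G s) η| :=
    fun s hs => Finset.sum_nonneg fun η _ => mul_nonneg (mul_nonneg zero_le_two
      (flow_pos hα hβ hm (mixture_pos μ) hs.1 η).le) (abs_nonneg _)
  refine (hP.lintegral_abs_integral_le hα hβ hm hT ht
    (fun η => aemeasurable_replacementError hG ε η)).trans ?_
  calc _ ≤ ∫⁻ s in Set.Ioc 0 t,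
        ENNReal.ofReal (δ + 1 / δ * (M ^ 2 * (c₁ + c₂ * (φ s / n)))) :=
        setLIntegral_mono' measurableSet_Ioc fun s hs =>
          ENNReal.ofReal_le_ofReal (key s ⟨hs.1.le, hs.2⟩)
    _ = ENNReal.ofReal (∫ s in Set.Ioc 0 t, (δ + 1 / δ * (M ^ 2 * (c₁ + c₂ * (φ s / n))))) := by
        rw [ofReal_integral_eq_lintegral_ofReal hψint]
        exact (ae_restrict_mem measurableSet_Ioc).mono fun s hs =>
          (hpos s ⟨hs.1.le, hs.2⟩).trans (key s ⟨hs.1.le, hs.2⟩)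
    _ ≤ _ := by
        refine ENNReal.ofReal_le_ofReal ?_
        have e : ∀ s, δ + 1 / δ * (M ^ 2 * (c₁ + c₂ * (φ s / n))) =
            (δ + 1 / δ * (M ^ 2 * c₁)) + 1 / δ * (M ^ 2 * (c₂ / n)) * φ s := fun s => by ring
        simp only [e]
        rw [← intervalIntegral.integral_of_le ht.1, intervalIntegral.integral_add
          intervalIntegrable_const (hφint.const_mul _), intervalIntegral.integral_const_mul,
          intervalIntegral.integral_const, smul_eq_mul, sub_zero]
        have h1 := mul_le_mul_of_nonneg_left hφI
          (by positivity : 0 ≤ 1 / δ * (M ^ 2 * (c₂ / n)))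
        refine (add_le_add le_rfl h1).trans (le_of_eq ?_)
        rw [errorBound, ← hc₁, ← hc₂, entropyConst]
        field_simp
        ring

end Assembly

/-! ### Passage to the limit in n, then in ε. -/

lemma IsTest.abs_bound {T M : ℝ} {G : ℝ → ℝ → ℝ} (hG : IsTest T M G) : IsTest T |M| G :=
  ⟨hG.1, fun s hs u hu => (hG.2 s hs u hu).trans (le_abs_self M)⟩

lemma tendsto_errorBound {α β a : ℝ} (ha : 1 < a) (M t δ ε : ℝ) (L : ℕ) :
    Tendsto (errorBound α β a M t δ ε L) atTop
      (𝓝 (δ * t + 1 / δ * (M ^ 2 * (t * (2 / (L + 1) + 120 * (L + 1) * (2 * ε)) +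
        entropyConst α β t * (6 * (L + 1) * (2 * ε)))))) := by
  have hc : ∀ c : ℝ, Tendsto (fun n : ℕ => c / (n : ℝ)) atTop (𝓝 0) :=
    tendsto_const_div_atTop_nhds_zero_nat
  have hpow : Tendsto (fun n : ℕ => 2 / (n : ℝ) ^ (a - 1)) atTop (𝓝 0) :=
    ((tendsto_rpow_atTop (sub_pos.2 ha)).comp tendsto_natCast_atTop_atTop).const_div_atTop 2
  have h2 : Tendsto (fun n : ℕ => (8 * (L : ℝ) + 12) * L / (2 * n)) atTop (𝓝 0) := by
    refine (hc ((8 * (L : ℝ) + 12) * L / 2)).congr fun n => ?_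
    rw [div_div]
  have h := ((((((hc L).const_add (2 / ((L : ℝ) + 1))).add
    ((hpow.add (hc 8)).const_mul ((8 * (L : ℝ) + 12) * L))).add
    (((hc 1).const_add (2 * ε)).const_mul (120 * ((L : ℝ) + 1)))).const_mul t).add
    ((h2.add (((hc 1).const_add (2 * ε)).const_mul (6 * ((L : ℝ) + 1)))).const_mul
      (entropyConst α β t))).const_mul (M ^ 2) |>.const_mul (1 / δ) |>.const_add (δ * t)
  simp only [add_zero, mul_zero, zero_add] at h
  exact h

theorem tendsto_limsup_iSup_expectedError {α β m θ a T : ℝ} (hα : α ∈ Set.Ioo (0 : ℝ) 1)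
    (hβ : β ∈ Set.Ioo (0 : ℝ) 1) (hm : 0 < m) (ha : a ∈ Set.Ioo (1 : ℝ) 2) (hT : 0 < T)
    (μ : (n : ℕ) → Measure (Config n)) (hμ : ∀ n, IsProbabilityMeasure (μ n))
    (P : (n : ℕ) → Measure (PathSpace T n)) (hP : ∀ n, IsLaw α β m θ a T n (μ n) (P n))
    (M t : ℝ) (ht : t ∈ Set.Icc (0 : ℝ) T) :
    Tendsto (fun ε : ℝ => limsup (fun n : ℕ => ⨆ (G : ℝ → ℝ → ℝ) (_ : IsTest T M G),
      expectedError α β hT (P n) ε t G) atTop) (𝓝[>] 0) (𝓝 0) := by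
  rw [ENNReal.tendsto_nhds_zero]
  intro κ hκ
  obtain ⟨r, hr0, hrκ⟩ := ENNReal.lt_iff_exists_nnreal_btwn.1 hκ
  have hr : (0 : ℝ) < r := by exact_mod_cast hr0
  have ht0 := ht.1
  -- Half of r is reserved for δt (the summand 1 covers t = 0) and half for the window error 2/(L +
  -- 1), with L chosen after δ. All remaining terms vanish at ε = 0.
  set δ : ℝ := r / (2 * (t + 1)) with hδdef
  have hδ : 0 < δ := by positivity
  have hδt : δ * t < r / 2 := by
    rw [hδdef, div_mul_eq_mul_div, div_lt_div_iff₀ (by positivity) two_pos]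
    nlinarith
  obtain ⟨N, hN⟩ := exists_nat_gt (1 / δ * (M ^ 2 * (t * 2)) / (r / 2))
  set L := N + 1 with hL
  have hLr : 1 / δ * (M ^ 2 * (t * (2 / ((L : ℝ) + 1)))) < r / 2 := by
    rw [div_lt_iff₀ (by positivity)] at hN
    have : 1 / δ * (M ^ 2 * (t * (2 / ((L : ℝ) + 1)))) =
        1 / δ * (M ^ 2 * (t * 2)) / (L + 1) := by ring
    rw [this, div_lt_iff₀ (by positivity)]
    refine hN.trans_le ?_
    rw [mul_comm]
    refine mul_le_mul_of_nonneg_left ?_ (by positivity)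
    rw [hL]; push_cast; linarith
  set lim : ℝ → ℝ := fun ε => δ * t + 1 / δ * (|M| ^ 2 * (t * (2 / ((L : ℝ) + 1) +
    120 * (L + 1) * (2 * ε)) + entropyConst α β t * (6 * (L + 1) * (2 * ε)))) with hlim
  have hcont : Continuous lim := by fun_prop
  have hlim0 : lim 0 < r := by
    simp only [hlim, mul_zero, add_zero, sq_abs]
    linarith
  have hev : ∀ᶠ ε in 𝓝[>] (0 : ℝ), lim ε < r :=
    nhdsWithin_le_nhds (hcont.continuousAt.eventually_lt continuousAt_const hlim0)
  filter_upwards [hev, self_mem_nhdsWithin] with ε hε hε0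
  have hε0 : 0 < ε := hε0
  refine le_trans (limsup_le_of_le (by isBoundedDefault) ?_) hrκ.le
  have hfloor : Tendsto (fun n : ℕ => ⌊ε * n⌋₊) atTop atTop :=
    tendsto_nat_floor_atTop.comp (tendsto_natCast_atTop_atTop.const_mul_atTop hε0)
  filter_upwards [eventually_ge_atTop 3, hfloor.eventually_ge_atTop L,
    (tendsto_errorBound (α := α) (β := β) ha.1 |M| t δ ε L).eventually_lt_const hε] with n hn hLn hb
  refine iSup₂_le fun G hG => ?_
  have := hμ n
  -- The sign of `M` is not assumed, so the bound is applied with |M|.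
  refine (expectedError_le (hP n) hα hβ hm ha.2.le hT hn ht (abs_nonneg M) hδ hε0.le
    (by omega) hLn hG.abs_bound).trans ?_
  rw [← ENNReal.ofReal_coe_nnreal]
  exact ENNReal.ofReal_le_ofReal hb.le

end PorousMedium

theorem theorem5p2
    (α β m θ a T : ℝ) (hα : α ∈ Set.Ioo (0 : ℝ) 1) (hβ : β ∈ Set.Ioo (0 : ℝ) 1)
    (hm : 0 < m) (hθ : 0 ≤ θ) (ha : a ∈ Set.Ioo (1 : ℝ) 2) (hT : 0 < T)
    (μ : (n : ℕ) → Measure (PorousMedium.Config n)) (hμ : ∀ n, IsProbabilityMeasure (μ n))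
    (P : (n : ℕ) → Measure (PorousMedium.PathSpace T n))
    (hP : ∀ n, PorousMedium.IsLaw α β m θ a T n (μ n) (P n))
    (M t : ℝ) (ht : t ∈ Set.Icc (0 : ℝ) T) :
    (∀ G : ℕ → ℝ → ℝ → ℝ, (∀ n, PorousMedium.IsTest T M (G n)) →
      Tendsto
        (fun ε : ℝ => limsup
          (fun n : ℕ => PorousMedium.expectedError α β hT (P n) ε t (G n)) atTop)
        (𝓝[>] 0) (𝓝 0)) ∧
    Tendsto
      (fun ε : ℝ => limsup
        (fun n : ℕ => ⨆ (G : ℝ → ℝ → ℝ) (_ : PorousMedium.IsTest T M G),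
          PorousMedium.expectedError α β hT (P n) ε t G) atTop)
      (𝓝[>] 0) (𝓝 0) := by
  have h := PorousMedium.tendsto_limsup_iSup_expectedError hα hβ hm ha hT μ hμ P hP M t ht
  refine ⟨fun G hG => ?_, h⟩
  refine tendsto_of_tendsto_of_tendsto_of_le_of_le tendsto_const_nhds h (fun _ => zero_le) ?_
  intro ε
  exact limsup_le_limsup (Eventually.of_forall fun n => le_iSup₂_of_le (G n) (hG n) le_rfl)
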